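/- The Horton–Strahler number $\mathrm{HS}(T)$ of a finite rooted tree $T$ is $0$ if $T$ is a single node, and otherwise it is the maximum of the Horton–Strahler numbers of the subtrees rooted at the children of the root, plus one if at least two children attain this maximum. Let $\xi$ be a random variable with values in $\{0,1,2,\dots\}$, $\mathbb{E}\{\xi\}=1$ and variance $\sigma^2\in(0,\infty)$, and let $T$ be a Galton–Watson tree (a random rooted ordered tree) with offspring distribution $\xi$; write $|T|$ for its number of nodes. For $n\ge 1$ let $\xi_1,\dots,\xi_n$ be independent copies of $\xi$, read as the numbers of children of nodes in preorder, so that the sequence codes a forest of rooted ordered trees, the last of which may be unfinished. Let $\eta_1=\eta_1^{(n)}$ be the Horton–Strahler number of the first tree of this forest, that is, of the unique finite rooted ordered tree whose preorder degree sequence is an initial segment of $(\xi_1,\dots,\xi_n)$; if there is no such tree (the first tree is unfinished), let $\eta_1=0$. Theorem. There is a constant $c$, depending only on the distribution of $\xi$, such that for all $n\ge 1$ with $\mathbf{P}\{|T|=n\}>0$ and all real $x$, $$\mathbf{P}\{\mathrm{HS}(T)\ge x \mid |T|=n\}\le c\,\sqrt{n}\;\mathbf{P}\{\eta_1\ge x-2\}.$$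 -/

import Mathlib

open MeasureTheory ProbabilityTheory
open scoped ENNReal

/-- Finite rooted ordered trees: a tree is a root together with the ordered list of the subtrees
rooted at its children. -/
inductive PlaneTree : Type where
  | node (children : List PlaneTree) : PlaneTree

namespace PlaneTree

/-- The number of nodes of the tree. -/
def size : PlaneTree → ℕ
  | node ts => 1 + (ts.map fun t => t.size).sum

/-- The value at a node whose children have the values in the list: the maximum, plus one if at
least two children attain it. A leaf (empty list) gets the value `0`. -/
def hsStep (l : List ℕ) : ℕ :=
  l.foldr max 0 + if 1 < l.count (l.foldr max 0) then 1 else 0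

/-- The Horton-Strahler number of the tree. -/
def hs : PlaneTree → ℕ
  | node ts => hsStep (ts.map fun t => t.hs)

/-- The degree sequence of the tree: the numbers of children of its nodes, in preorder. -/
def degrees : PlaneTree → List ℕ
  | node ts => ts.length :: (ts.map fun t => t.degrees).flatten

/-- The probability that the Galton-Watson tree with offspring distribution `p` is a given finite
tree: the root has the right number of children, and the subtrees of the children are
independent Galton-Watson trees. It is the product of `p (deg v)` over the nodes `v`. -/
noncomputable def weight (p : PMF ℕ) : PlaneTree → ℝ≥0∞
  | node ts => p ts.length * (ts.map fun t => weight p t).prod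

instance : MeasurableSpace PlaneTree := ⊤

end PlaneTree

/-- The law of the (unconditional) Galton-Watson tree with offspring distribution `p`, on the
countable set of finite rooted ordered trees. -/
noncomputable def galtonWatson (p : PMF ℕ) : Measure PlaneTree :=
  Measure.sum fun t => PlaneTree.weight p t • Measure.dirac t

/-- The law of `n` independent random variables with distribution `p`. -/
noncomputable def iidDegrees (p : PMF ℕ) (n : ℕ) : Measure (Fin n → ℕ) :=
  Measure.pi fun _ => p.toMeasure

open scoped Classical in
/-- The Horton-Strahler number of the first tree in the forest coded in preorder by the degree
sequence `d`, that is, of the tree whose degree sequence is an initial segment of `d` (there is at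
most one, see `PlaneTree.eq_of_degrees_prefix`); it is `0` if the first tree is unfinished. -/
noncomputable def firstTreeHS {n : ℕ} (d : Fin n → ℕ) : ℕ :=
  if h : ∃ t : PlaneTree, t.degrees <+: List.ofFn d then h.choose.hs else 0

namespace PlaneTree

theorem eq_of_degrees_append : ∀ (s t : PlaneTree) (l m : List ℕ),
    s.degrees ++ l = t.degrees ++ m → s = t ∧ l = m
  | node ss, node ts, l, m, h => by
    simp only [degrees, List.cons_append, List.cons.injEq] at h
    obtain ⟨hl, h⟩ := h
    have key : ∀ us : List PlaneTree, (∀ u ∈ us, u ∈ ss) → ∀ vs : List PlaneTree,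
        us.length = vs.length →
        (us.map fun t => t.degrees).flatten ++ l = (vs.map fun t => t.degrees).flatten ++ m →
        us = vs ∧ l = m := by
      intro us
      induction us with
      | nil =>
        intro _ vs hlen h
        obtain rfl : vs = [] := List.length_eq_zero_iff.mp hlen.symm
        simpa using h
      | cons u us ih =>
        intro hu vs hlen h
        cases vs with
        | nil => simp at hlen
        | cons v vs =>
          simp only [List.map_cons, List.flatten_cons, List.append_assoc] at h
          have hmem : u ∈ ss := hu u (by simp)
          obtain ⟨h1, h2⟩ := eq_of_degrees_append u v _ _ h
          obtain ⟨h3, h4⟩ := ih (fun w hw => hu w (by simp [hw])) vs (by simpa using hlen) h2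
          exact ⟨by rw [h1, h3], h4⟩
    obtain ⟨h1, h2⟩ := key ss (fun _ h => h) ts hl h
    exact ⟨by rw [h1], h2⟩
  termination_by s => sizeOf s
  decreasing_by
    have := List.sizeOf_lt_of_mem hmem
    simp
    omega

/-- At most one tree has a degree sequence that is an initial segment of a given sequence. -/
theorem eq_of_degrees_prefix {s t : PlaneTree} {l : List ℕ} (hs : s.degrees <+: l)
    (ht : t.degrees <+: l) : s = t := by
  obtain ⟨a, ha⟩ := hs
  obtain ⟨b, hb⟩ := ht
  exact (eq_of_degrees_append s t a b (ha.trans hb.symm)).1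

end PlaneTree

/-! Code a tree by its preorder degree sequence and follow the Łukasiewicz walk, whose steps are the
degrees minus one. A sequence codes a forest of `k` trees exactly when the walk ends at `-k` and has
been above `-k` until then, and a cyclic sequence of total excess `-1` is the code of a tree from
exactly one starting point.

Combinatorial core (`size_le_largeSuffixes`): cut the code of a tree before some node. The remaining
suffix codes a forest, made of the subtree of that node and the subtrees hanging to the right of its
ancestral path. If the tree has Horton–Strahler number above `h`, then in the tree and its mirror
image together at least `|T|` such suffixes contain a tree of number at least `h`. The mirror image
has the same size and weight, so `n P(|T| = n, HS > h)` is at most twice the total weight of the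
pairs (tree of size `n`, good cut).

For a good cut, rotate the sequence so that it starts there. It then reads: a forest code, a large
tree `v`, and a remainder whose excess cancels that of the forest. The tree and the cut are
recovered from this triple, because the starting point of a tree code on a cycle is unique
(`tsum_largeSuffixes_le`). For given `v`, a forest code of length `j` has probability `O(1/√(j+1))`
by the rotation count and `E|S_j - j| = O(√j)`, and the remainder of length `m` has a prescribed sum
with probability `O(1/√(m+1))` by Fourier inversion. The convolution of these two bounds is bounded,
so only the weights of the trees `v` with `|v| ≤ n` and `HS(v) ≥ h` remain, and their sum is at most
`P(η₁ ≥ h)`. Hence `n P(|T| = n, HS > h) ≤ K P(η₁ ≥ h)` (`exists_mul_galtonWatson_le`).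

For the denominator, the cycle lemma gives `n P(|T| = n) ≥ P(S_n = n - 1)`, and the local limit
theorem bounds this below by `c/√n` whenever it is nonzero. The quotient produces the factor `√n`.
-/

namespace PlaneTree

/-! ### Forests, Łukasiewicz walks and the cycle lemma. -/

/-- The concatenated degree sequences of the trees of a forest. -/
def forestDegrees (ts : List PlaneTree) : List ℕ := (ts.map fun t => t.degrees).flatten

@[simp] theorem forestDegrees_nil : forestDegrees [] = [] := rfl

@[simp] theorem forestDegrees_cons (t : PlaneTree) (ts : List PlaneTree) :
    forestDegrees (t :: ts) = t.degrees ++ forestDegrees ts := by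
  simp [forestDegrees]

@[simp] theorem forestDegrees_append (ss ts : List PlaneTree) :
    forestDegrees (ss ++ ts) = forestDegrees ss ++ forestDegrees ts := by
  simp [forestDegrees]

theorem degrees_node (cs : List PlaneTree) :
    (node cs).degrees = cs.length :: forestDegrees cs := by
  rw [degrees, forestDegrees]

theorem forestDegrees_node_cons (cs ts : List PlaneTree) :
    forestDegrees (node cs :: ts) = cs.length :: forestDegrees (cs ++ ts) := by
  simp [degrees_node]

theorem induction_children {P : PlaneTree → Prop}
    (h : ∀ cs : List PlaneTree, (∀ c ∈ cs, P c) → P (node cs)) : ∀ t, P t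
  | node cs => h cs fun c _ => induction_children h c
  termination_by t => sizeOf t
  decreasing_by
    have := List.sizeOf_lt_of_mem ‹c ∈ cs›
    simp
    omega

/-- Induction on forests in preorder: remove the root of the first tree. -/
theorem forest_induction {P : List PlaneTree → Prop} (h0 : P [])
    (h1 : ∀ cs ts, P (cs ++ ts) → P (node cs :: ts)) (ts : List PlaneTree) : P ts := by
  induction hn : (forestDegrees ts).length generalizing ts with
  | zero =>
    cases ts with
    | nil => exact h0
    | cons t ts => cases t; simp [degrees_node] at hn
  | succ n ih =>
    cases ts with
    | nil => exact h0
    | cons t ts =>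
      obtain ⟨cs⟩ := t
      refine h1 cs ts (ih _ ?_)
      rw [forestDegrees_node_cons] at hn
      simpa using hn

theorem length_degrees (t : PlaneTree) : t.degrees.length = t.size := by
  induction t using induction_children with
  | h cs ih =>
    rw [degrees_node, size, forestDegrees, List.length_cons, List.length_flatten, List.map_map,
      add_comm]
    congr 2
    exact List.map_congr_left ih

/-- The final height of the Łukasiewicz walk with the given degrees. -/
def excess (l : List ℕ) : ℤ := (l.sum : ℤ) - l.length

@[simp] theorem excess_nil : excess [] = 0 := rfl

@[simp] theorem excess_cons (a : ℕ) (l : List ℕ) : excess (a :: l) = a - 1 + excess l := by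
  simp [excess]; ring

@[simp] theorem excess_append (l m : List ℕ) : excess (l ++ m) = excess l + excess m := by
  simp [excess]; ring

theorem excess_forestDegrees (ts : List PlaneTree) :
    excess (forestDegrees ts) = -(ts.length : ℤ) := by
  induction ts using forest_induction with
  | h0 => simp
  | h1 cs ts ih =>
    rw [forestDegrees_node_cons, excess_cons, ih]
    push_cast [List.length_append, List.length_cons]
    ring

theorem excess_degrees (t : PlaneTree) : excess t.degrees = -1 := by
  simpa using excess_forestDegrees [t]

/-- Each tree lowers the walk by one, and a forest code ends at the first passage to its final
level. -/
theorem neg_length_lt_excess (ts : List PlaneTree) (A B : List ℕ)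
    (h : forestDegrees ts = A ++ B) (hB : B ≠ []) : -(ts.length : ℤ) < excess A := by
  induction ts using forest_induction generalizing A with
  | h0 => simp at h; exact absurd h.2 hB
  | h1 cs ts ih =>
    cases A with
    | nil => simp; omega
    | cons a A =>
      rw [forestDegrees_node_cons, List.cons_append, List.cons.injEq] at h
      have := ih A h.2
      simp at this ⊢
      omega

/-- Converse to `neg_length_lt_excess`. After a first degree `a`, the rest codes `k - 1 + a` trees,
the first `a` of which become the children of the first root. -/
theorem exists_forest (l : List ℕ) (k : ℕ) (hk : excess l = -k)
    (h : ∀ A B, l = A ++ B → B ≠ [] → -(k : ℤ) < excess A) :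
    ∃ ts : List PlaneTree, ts.length = k ∧ forestDegrees ts = l := by
  induction l generalizing k with
  | nil => exact ⟨[], by simp at hk; simp [hk], rfl⟩
  | cons a l ih =>
    have hk1 := h [] (a :: l) rfl (by simp)
    simp at hk1 hk
    obtain ⟨ts, h1, h2⟩ := ih (k - 1 + a) (by omega) fun A B hAB hB => by
      have := h (a :: A) B (by simp [hAB]) hB
      simp at this
      omega
    refine ⟨node (ts.take a) :: ts.drop a, by simp; omega, ?_⟩
    rw [forestDegrees_node_cons, List.take_append_drop, h2]
    simp; omega

theorem exists_tree (l : List ℕ) (hk : excess l = -1)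
    (h : ∀ A B, l = A ++ B → B ≠ [] → 0 ≤ excess A) : ∃ t : PlaneTree, t.degrees = l := by
  obtain ⟨ts, h1, h2⟩ := exists_forest l 1 (by simpa using hk) fun A B hAB hB => by
    have := h A B hAB hB
    simp; omega
  obtain ⟨t, rfl⟩ := List.length_eq_one_iff.1 h1
  exact ⟨t, by simpa using h2⟩

theorem excess_prefix_degrees_nonneg {t : PlaneTree} {A B : List ℕ} (h : t.degrees = A ++ B)
    (hB : B ≠ []) : 0 ≤ excess A := by
  have := neg_length_lt_excess [t] A B (by simpa using h) hB
  simp at this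
  omega

theorem degrees_injective : Function.Injective degrees := fun s t h =>
  (eq_of_degrees_append s t [] [] (by simpa using h)).1

theorem degrees_ne_nil (t : PlaneTree) : t.degrees ≠ [] := by
  cases t; simp [degrees_node]

theorem size_pos (t : PlaneTree) : 0 < t.size := by
  rw [← length_degrees]
  exact List.length_pos_iff.2 t.degrees_ne_nil

/-- As proper prefixes of tree codes, `X` and `Y` both have nonnegative excess, but their excesses
add up to `-1`. -/
theorem not_degrees_rotation {s t : PlaneTree} {X Y : List ℕ} (hs : s.degrees = X ++ Y)
    (ht : t.degrees = Y ++ X) (hX : X ≠ []) (hY : Y ≠ []) : False := by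
  have h1 := excess_prefix_degrees_nonneg hs hY
  have h2 := excess_prefix_degrees_nonneg ht hX
  have h3 := excess_degrees s
  rw [hs, excess_append] at h3
  omega

/-- A cyclic sequence is the degree sequence of a tree from at most one starting point. -/
theorem eq_of_rotation_eq {s t : PlaneTree} {A B A' B' : List ℕ} (hs : s.degrees = A ++ B)
    (ht : t.degrees = A' ++ B') (hB : B ≠ []) (hB' : B' ≠ []) (h : B ++ A = B' ++ A') :
    A = A' ∧ B = B' := by
  rcases List.append_eq_append_iff.1 h with ⟨Z, rfl, rfl⟩ | ⟨Z, rfl, rfl⟩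
  · rcases eq_or_ne Z [] with rfl | hZ
    · simp
    · exact (not_degrees_rotation (X := Z) (Y := A' ++ B) (by simpa using hs) (by simpa using ht) hZ
        (by simp [hB])).elim
  · rcases eq_or_ne Z [] with rfl | hZ
    · simp
    · exact (not_degrees_rotation (X := A ++ B') (Y := Z) (by simpa using hs) (by simpa using ht)
        (by simp [hB']) hZ).elim

/-- Every sequence with total excess `-1` has a rotation that is the degree sequence of a tree. -/
theorem exists_rotate_eq_degrees (l : List ℕ) (hl : excess l = -1) :
    ∃ k < l.length, ∃ t : PlaneTree, t.degrees = l.rotate k := by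
  have hpos : 0 < l.length := by
    rcases l with _ | ⟨a, l⟩
    · simp at hl
    · simp
  obtain ⟨i, -, hi⟩ := Finset.exists_min_image (Finset.range (l.length + 1))
    (fun k => excess (l.take k)) ⟨0, by simp⟩
  have hex : ∃ k, excess (l.take k) = excess (l.take i) := ⟨i, rfl⟩
  classical
  -- Cut where the walk first attains its minimum. From there on it stays at or above that level.
  -- The part before the cut was strictly above it, so after the total descent of one it still does
  -- not fall below.
  obtain ⟨k, hk, hmin⟩ : ∃ k, excess (l.take k) = excess (l.take i) ∧
      ∀ m < k, excess (l.take m) ≠ excess (l.take i) :=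
    ⟨Nat.find hex, Nat.find_spec hex, fun m hm => Nat.find_min hex hm⟩
  have hle : ∀ m, excess (l.take i) ≤ excess (l.take m) := fun m => by
    rcases le_or_gt m l.length with hm | hm
    · exact hi m (by simp; omega)
    · rw [List.take_of_length_le hm.le]
      simpa using hi l.length (by simp)
  have hkl : k ≤ l.length := by
    by_contra! hlt
    refine hmin l.length hlt ?_
    rw [List.take_length, ← hk, List.take_of_length_le hlt.le]
  -- The minimum may first be attained at the very end, `k = l.length`, hence the reduction.
  refine ⟨k % l.length, Nat.mod_lt _ hpos, ?_⟩
  rw [List.rotate_mod, List.rotate_eq_drop_append_take hkl]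
  have htot : excess (l.take k) + excess (l.drop k) = -1 := by
    rw [← excess_append, List.take_append_drop, hl]
  refine exists_tree _ (by rw [excess_append]; omega) fun A B hAB hB => ?_
  rcases List.append_eq_append_iff.1 hAB with ⟨Z, rfl, hZ⟩ | ⟨Z, hZ, rfl⟩
  · have hZt : Z = l.take Z.length := by
      have : Z <+: l := (List.prefix_append Z B).trans (hZ ▸ List.take_prefix k l)
      exact List.prefix_iff_eq_take.1 this
    have hlt : Z.length < k := by
      have h1 := congrArg List.length hZ
      have h2 := List.length_pos_iff.2 hB
      simp at h1
      omega
    have h3 := hmin _ hlt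
    have h4 := hle Z.length
    rw [← hZt] at h3 h4
    rw [excess_append]
    omega
  · have h1 : l.take k ++ A = l.take (k + A.length) := by
      have h3 : l.take k ++ A <+: l :=
        ⟨Z, by rw [List.append_assoc, ← hZ, List.take_append_drop]⟩
      rw [List.prefix_iff_eq_take.1 h3]
      simp [hkl]
    have h2 := hle (k + A.length)
    rw [← h1, excess_append] at h2
    omega

/-- The number of rotations of a sequence that code a forest is at most minus its excess. -/
theorem card_forest_rotations_le (l : List ℕ) (S : Finset ℕ)
    (hS : ∀ k ∈ S, k < l.length ∧ ∃ ts : List PlaneTree, forestDegrees ts = l.rotate k) :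
    (S.card : ℤ) ≤ |excess l| := by
  rcases S.eq_empty_or_nonempty with rfl | hne
  · simp
  have hex : ∀ k ∈ S, ∃ ts : List PlaneTree, forestDegrees ts = l.drop k ++ l.take k ∧
      -(ts.length : ℤ) = excess l := fun k hk => by
    obtain ⟨hkl, ts, hts⟩ := hS k hk
    rw [List.rotate_eq_drop_append_take hkl.le] at hts
    refine ⟨ts, hts, ?_⟩
    rw [← excess_forestDegrees, hts, excess_append, add_comm, ← excess_append,
      List.take_append_drop]
  -- First passage, applied to the forests started at `k` and at `i`: along the good starting points
  -- the heights strictly decrease, but by less than `|excess l|` in all. They are thus distinct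
  -- integers in a window of that length.
  have key : ∀ i ∈ S, ∀ k ∈ S, i < k → excess (l.take k) < excess (l.take i) ∧
      excess (l.take i) + excess l < excess (l.take k) := fun i hi k hk hik => by
    have hkl := (hS k hk).1
    obtain ⟨ts, h1, h2⟩ := hex i hi
    obtain ⟨us, h3, h4⟩ := hex k hk
    have hik' : l.take k = l.take i ++ (l.drop i).take (k - i) := by
      rw [← List.take_add]; congr 1; omega
    have htot : excess (l.take k) + excess (l.drop k) = excess l := by
      rw [← excess_append, List.take_append_drop]
    constructor
    · have := neg_length_lt_excess us (l.drop k ++ l.take i) ((l.drop i).take (k - i))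
        (by rw [h3, hik', List.append_assoc]) (by simp; omega)
      rw [excess_append] at this
      omega
    · have := neg_length_lt_excess ts ((l.drop i).take (k - i))
        ((l.drop i).drop (k - i) ++ l.take i)
        (by rw [h1, ← List.append_assoc, List.take_append_drop]) (by simp; omega)
      rw [hik', excess_append]
      omega
  have hneg : excess l < 0 := by
    obtain ⟨k, hk⟩ := hne
    obtain ⟨ts, h1, h2⟩ := hex k hk
    rcases ts with _ | ⟨t, ts⟩
    · have := congrArg List.length h1
      have := (hS k hk).1
      simp at *
      omega
    · simp at h2; omega
  have hinj : Set.InjOn (fun k => excess (l.take k)) (S : Set ℕ) := fun i hi k hk h => by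
    simp only at h
    rcases lt_trichotomy i k with hlt | heq | hlt
    · have := key i hi k hk hlt; omega
    · exact heq
    · have := key k hk i hi hlt; omega
  rw [← Finset.card_image_of_injOn hinj]
  obtain ⟨m, hm, hmin⟩ := Finset.exists_min_image S (fun k => excess (l.take k)) hne
  have hsub : S.image (fun k => excess (l.take k)) ⊆
      Finset.Ico (excess (l.take m)) (excess (l.take m) + |excess l|) := by
    intro z hz
    obtain ⟨k, hk, rfl⟩ := Finset.mem_image.1 hz
    have h1 := hmin k hk
    rw [Finset.mem_Ico, abs_of_neg hneg]
    refine ⟨h1, ?_⟩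
    rcases lt_trichotomy k m with hlt | rfl | hlt
    · have := key k hk m hm hlt; omega
    · omega
    · have := key m hm k hk hlt; omega
  calc ((S.image (fun k => excess (l.take k))).card : ℤ)
      ≤ ((Finset.Ico (excess (l.take m)) (excess (l.take m) + |excess l|)).card : ℤ) := by
        exact_mod_cast Finset.card_le_card hsub
    _ = |excess l| := by simp

end PlaneTree

/-! ### Suffixes that contain a large tree, and mirror images. -/

namespace PlaneTree

/-- The sequence codes a forest that has a tree with Horton-Strahler number at least `h`. -/
def CodesLarge (h : ℕ) (l : List ℕ) : Prop :=
  ∃ ts : List PlaneTree, forestDegrees ts = l ∧ ∃ t ∈ ts, h ≤ t.hs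

open scoped Classical in
/-- The number of suffixes of the sequence that code a forest with a large tree. -/
noncomputable def largeSuffixes (h : ℕ) (l : List ℕ) : ℕ :=
  ((Finset.range l.length).filter fun k => CodesLarge h (l.drop k)).card

theorem forestDegrees_injective : Function.Injective forestDegrees := by
  intro ss
  induction ss using forest_induction with
  | h0 =>
    intro ts h
    rcases ts with _ | ⟨t, ts⟩
    · rfl
    · have := t.degrees_ne_nil
      simp_all
  | h1 cs ss ih =>
    intro ts h
    rcases ts with _ | ⟨t, ts⟩
    · simp [degrees_node] at h
    · obtain ⟨h1, h2⟩ := eq_of_degrees_append (node cs) t (forestDegrees ss) (forestDegrees ts)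
        (by simpa using h)
      rw [h1]
      congr 1
      have := @ih (cs ++ ts) (by simp [h2])
      simpa using this

theorem codesLarge_forestDegrees {h : ℕ} {ts : List PlaneTree} :
    CodesLarge h (forestDegrees ts) ↔ ∃ t ∈ ts, h ≤ t.hs := by
  constructor
  · rintro ⟨us, h1, h2⟩
    rwa [← forestDegrees_injective h1]
  · exact fun h1 => ⟨ts, rfl, h1⟩

theorem hs_node (cs : List PlaneTree) : (node cs).hs = hsStep (cs.map fun t => t.hs) := by
  rw [hs]

theorem foldr_max_mem {l : List ℕ} (h : 0 < l.foldr max 0) : l.foldr max 0 ∈ l := by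
  induction l with
  | nil => simp at h
  | cons b l ih =>
    rw [List.foldr_cons] at *
    rcases le_total b (l.foldr max 0) with hb | hb
    · rw [max_eq_right hb] at *
      exact List.mem_cons_of_mem _ (ih h)
    · rw [max_eq_left hb]
      exact List.mem_cons_self

theorem hsStep_perm {l m : List ℕ} (h : l.Perm m) : hsStep l = hsStep m := by
  have h1 : l.foldr max 0 = m.foldr max 0 := h.foldr_eq 0
  rw [hsStep, hsStep, h1, h.count_eq]

/-- A node of Horton-Strahler number at least `h + 1` has a child with this property, or two
children with number at least `h`. -/
theorem children_of_lt_hs {h : ℕ} {cs : List PlaneTree} (hh : h < (node cs).hs) :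
    (∃ c ∈ cs, h < c.hs) ∨ ∃ u v w : List PlaneTree, ∃ a b : PlaneTree,
      cs = u ++ a :: v ++ b :: w ∧ h ≤ a.hs ∧ h ≤ b.hs := by
  rw [hs_node, hsStep] at hh
  set l := cs.map fun t => t.hs with hl
  by_cases hM : h < l.foldr max 0
  · left
    obtain ⟨c, hc, hc'⟩ := List.mem_map.1 (foldr_max_mem (by omega : 0 < l.foldr max 0))
    exact ⟨c, hc, by simpa [hc'] using hM⟩
  · right
    have h1 : l.foldr max 0 = h ∧ 1 < l.count (l.foldr max 0) := by
      split_ifs at hh with hc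
      · exact ⟨by omega, hc⟩
      · omega
    rw [h1.1] at h1
    have h2 : List.Sublist [h, h] l := by
      have := List.replicate_sublist_iff.2 (show 2 ≤ l.count h from h1.2)
      simpa [List.replicate] using this
    obtain ⟨l1, hl1, hl2⟩ := List.sublist_map_iff.1 h2
    obtain ⟨a, b, rfl⟩ : ∃ a b, l1 = [a, b] := by
      rcases l1 with _ | ⟨a, _ | ⟨b, _ | ⟨c, l1⟩⟩⟩ <;> simp at hl2
      exact ⟨a, b, rfl⟩
    simp at hl2
    obtain ⟨u, r, rfl, hr1, hr2⟩ := List.cons_sublist_iff.1 hl1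
    obtain ⟨u1, u2, rfl⟩ := List.append_of_mem hr1
    obtain ⟨w1, w2, rfl⟩ := List.append_of_mem (List.singleton_sublist.1 hr2)
    exact ⟨u1, u2 ++ w1, w2, a, b, by simp, hl2.1.le, hl2.2.le⟩

theorem largeSuffixes_cons (h a : ℕ) (l : List ℕ) [Decidable (CodesLarge h (a :: l))] :
    largeSuffixes h (a :: l) = (if CodesLarge h (a :: l) then 1 else 0) + largeSuffixes h l := by
  classical
  rw [largeSuffixes, largeSuffixes, List.length_cons, Finset.card_filter, Finset.card_filter,
    Finset.sum_range_succ', add_comm]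
  simp

/-- Trees added on the right extend every suffix forest and remove no large tree from it. -/
theorem largeSuffixes_append_le (h : ℕ) (us vs : List PlaneTree) :
    largeSuffixes h (forestDegrees us) ≤ largeSuffixes h (forestDegrees (us ++ vs)) := by
  classical
  induction us using forest_induction with
  | h0 => simp [largeSuffixes]
  | h1 cs ts ih =>
    have hM : CodesLarge h (forestDegrees (node cs :: ts)) →
        CodesLarge h (forestDegrees (node cs :: ts ++ vs)) := by
      rw [codesLarge_forestDegrees, codesLarge_forestDegrees]
      rintro ⟨t, ht, h1⟩
      exact ⟨t, by simp at ht ⊢; tauto, h1⟩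
    rw [List.cons_append, forestDegrees_node_cons, forestDegrees_node_cons] at *
    rw [largeSuffixes_cons, largeSuffixes_cons, List.append_assoc] at *
    split_ifs with h1 h2 h2
    · omega
    · exact (h2 (hM h1)).elim
    · omega
    · omega

/-- A large tree in `vs` lies in every suffix that starts inside `us`, so all positions of `us`
count. -/
theorem largeSuffixes_append_large (h : ℕ) (us vs : List PlaneTree) (hv : ∃ t ∈ vs, h ≤ t.hs) :
    (forestDegrees us).length + largeSuffixes h (forestDegrees vs) ≤
      largeSuffixes h (forestDegrees (us ++ vs)) := by
  classical
  induction us using forest_induction with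
  | h0 => simp
  | h1 cs ts ih =>
    have hM : CodesLarge h (forestDegrees (node cs :: ts ++ vs)) := by
      rw [codesLarge_forestDegrees]
      obtain ⟨t, ht, h1⟩ := hv
      exact ⟨t, by simp [ht], h1⟩
    rw [List.cons_append, forestDegrees_node_cons] at hM
    rw [List.cons_append, forestDegrees_node_cons, forestDegrees_node_cons]
    rw [largeSuffixes_cons, if_pos hM, ← List.append_assoc, List.length_cons]
    omega

/-- The mirror image of the tree. -/
def mirror : PlaneTree → PlaneTree
  | node ts => node (ts.map fun t => mirror t).reverse

theorem mirror_node (cs : List PlaneTree) :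
    (node cs).mirror = node (cs.map mirror).reverse := by
  rw [mirror]

theorem mirror_mirror (t : PlaneTree) : t.mirror.mirror = t := by
  induction t using induction_children with
  | h cs ih =>
    rw [mirror_node, mirror_node, List.map_reverse, List.reverse_reverse, List.map_map]
    congr 1
    conv_rhs => rw [← List.map_id cs]
    exact List.map_congr_left ih

theorem hs_mirror (t : PlaneTree) : t.mirror.hs = t.hs := by
  induction t using induction_children with
  | h cs ih =>
    rw [mirror_node, hs_node, hs_node, List.map_reverse, hsStep_perm (List.reverse_perm _),
      List.map_map]
    congr 1
    exact List.map_congr_left ih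

theorem size_mirror (t : PlaneTree) : t.mirror.size = t.size := by
  induction t using induction_children with
  | h cs ih =>
    rw [mirror_node, size, size, List.map_reverse, List.sum_reverse, List.map_map]
    congr 2
    exact List.map_congr_left ih

theorem weight_mirror (p : PMF ℕ) (t : PlaneTree) : t.mirror.weight p = t.weight p := by
  induction t using induction_children with
  | h cs ih =>
    rw [mirror_node, weight, weight, List.map_reverse, List.prod_reverse, List.map_map,
      List.length_reverse, List.length_map]
    congr 2
    exact List.map_congr_left ih

theorem size_node (cs : List PlaneTree) : (node cs).size = 1 + (forestDegrees cs).length := by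
  rw [← length_degrees, degrees_node, List.length_cons, add_comm]

theorem length_forestDegrees_mirror (ts : List PlaneTree) :
    (forestDegrees (ts.map mirror).reverse).length = (forestDegrees ts).length := by
  have := size_mirror (node ts)
  rw [mirror_node, size_node, size_node] at this
  omega

theorem largeSuffixes_node {h : ℕ} {cs : List PlaneTree} (hh : h ≤ (node cs).hs) :
    largeSuffixes h (node cs).degrees = 1 + largeSuffixes h (forestDegrees cs) := by
  classical
  have : CodesLarge h (node cs).degrees := ⟨[node cs], by simp, node cs, by simp, hh⟩
  rw [degrees_node] at *
  rw [largeSuffixes_cons, if_pos this]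

/-- Starting from at least half of the nodes of the tree, in one of the two orientations, the
subtrees to the right of the path to the node include a large one. -/
theorem size_le_largeSuffixes {h : ℕ} (t : PlaneTree) (ht : h < t.hs) :
    t.size ≤ largeSuffixes h t.degrees + largeSuffixes h t.mirror.degrees := by
  induction t using induction_children with
  | h cs ih =>
    have hm : h ≤ (node cs).mirror.hs := by rw [hs_mirror]; exact ht.le
    rw [mirror_node] at *
    rw [largeSuffixes_node ht.le, largeSuffixes_node hm, size_node]
    -- If one child `c` is above `h`, nodes left of `c` count in the tree, nodes right of `c` count
    -- in the mirror image, and induction handles `c`. If two children `a`, `b` reach `h`,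
    -- everything before `b` counts in the tree and everything after `a` in the mirror image, which
    -- already covers all nodes.
    rcases children_of_lt_hs ht with ⟨c, hc, hch⟩ | ⟨u, v, w, a, b, rfl, ha, hb⟩
    · have hi := ih c hc hch
      obtain ⟨u, w, rfl⟩ := List.append_of_mem hc
      have h1 := largeSuffixes_append_large h u [c] ⟨c, by simp, hch.le⟩
      have h2 := largeSuffixes_append_le h (u ++ [c]) w
      have h3 := largeSuffixes_append_large h (w.map mirror).reverse [c.mirror]
        ⟨c.mirror, by simp, by rw [hs_mirror]; exact hch.le⟩
      have h4 := largeSuffixes_append_le h ((w.map mirror).reverse ++ [c.mirror])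
        (u.map mirror).reverse
      have h5 := length_forestDegrees_mirror w
      have h6 := c.length_degrees
      simp only [forestDegrees_append, forestDegrees_cons, forestDegrees_nil, List.append_nil,
        List.append_assoc, List.map_append, List.map_cons, List.reverse_append, List.reverse_cons,
        List.length_append] at *
      omega
    · have hpos : ∀ t : PlaneTree, h ≤ t.hs → 1 ≤ largeSuffixes h t.degrees := fun t h1 => by
        cases t
        rw [largeSuffixes_node h1]
        omega
      have h0 := hpos b hb
      have h0' := hpos a.mirror (by rw [hs_mirror]; exact ha)
      have h1 := largeSuffixes_append_large h (u ++ a :: v) [b] ⟨b, by simp, hb⟩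
      have h2 := largeSuffixes_append_le h (u ++ a :: v ++ [b]) w
      have h3 := largeSuffixes_append_large h ((v ++ b :: w).map mirror).reverse [a.mirror]
        ⟨a.mirror, by simp, by rw [hs_mirror]; exact ha⟩
      have h4 := largeSuffixes_append_le h (((v ++ b :: w).map mirror).reverse ++ [a.mirror])
        (u.map mirror).reverse
      have h5 := length_forestDegrees_mirror (v ++ b :: w)
      have h6 := b.length_degrees
      have h7 := b.size_pos
      simp only [forestDegrees_append, forestDegrees_cons, forestDegrees_nil, List.append_nil,
        List.append_assoc, List.map_append, List.map_cons, List.reverse_append, List.reverse_cons,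
        List.nil_append, List.length_append, List.cons_append] at *
      omega

end PlaneTree

/-! ### Lattice span and Fourier inversion. -/

theorem ae_pmf_ne_zero (p : PMF ℕ) : ∀ᵐ k ∂p.toMeasure, p k ≠ 0 := by
  rw [ae_iff, PMF.toMeasure_apply_eq_zero_iff _ (MeasurableSet.of_discrete), Set.disjoint_left]
  intro k hk
  simpa using hk

theorem ae_pmf_iff {p : PMF ℕ} {P : ℕ → Prop} :
    (∀ᵐ k ∂p.toMeasure, P k) ↔ ∀ k, p k ≠ 0 → P k := by
  rw [ae_iff, PMF.toMeasure_apply_eq_zero_iff _ (MeasurableSet.of_discrete), Set.disjoint_left]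
  refine forall_congr' fun k => ?_
  simp [PMF.mem_support_iff]

/-- The span of the support of the offspring distribution. -/
theorem exists_span {p : PMF ℕ} {k₀ : ℕ} (hk₀ : k₀ ≠ 0) (hp : p k₀ ≠ 0) :
    ∃ d : ℕ, 0 < d ∧ (∀ k, p k ≠ 0 → d ∣ k) ∧
      ∀ t : ℝ, (∀ k : ℕ, p k ≠ 0 → Complex.exp (t * k * Complex.I) = 1) →
        Complex.exp (t * d * Complex.I) = 1 := by
  set J : Ideal ℤ := Ideal.span {m | ∃ k : ℕ, p k ≠ 0 ∧ (k : ℤ) = m} with hJ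
  have hmem : ∀ k, p k ≠ 0 → (k : ℤ) ∈ J := fun k hk => Ideal.subset_span ⟨k, hk, rfl⟩
  set g := Submodule.IsPrincipal.generator J with hg
  have hdvd : ∀ m ∈ J, g ∣ m := fun m hm => by
    rwa [hg, ← Submodule.IsPrincipal.mem_iff_generator_dvd]
  refine ⟨g.natAbs, ?_, fun k hk => Int.natAbs_dvd_natAbs.2 (hdvd k (hmem k hk)), fun t ht => ?_⟩
  · rw [Int.natAbs_pos]
    intro h0
    have := hdvd k₀ (hmem k₀ hp)
    rw [h0, zero_dvd_iff] at this
    exact hk₀ (by exact_mod_cast this)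
  -- The integers `m` with `exp (i t m) = 1` form an ideal, so it suffices to check the generators.
  · have hall : ∀ m ∈ J, Complex.exp (t * (m : ℤ) * Complex.I) = 1 := by
      intro m hm
      induction hm using Submodule.span_induction with
      | mem m hm =>
        obtain ⟨k, hk, rfl⟩ := hm
        simpa using ht k hk
      | zero => simp
      | add x y _ _ hx hy =>
        push_cast
        rw [mul_add, add_mul, Complex.exp_add, hx, hy, one_mul]
      | smul a x _ hx =>
        have : (t * ((a • x : ℤ) : ℂ) * Complex.I) = a * (t * (x : ℤ) * Complex.I) := by
          simp; ring
        rw [this, Complex.exp_int_mul, hx, one_zpow]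
    have hg1 := hall g (Submodule.IsPrincipal.generator_mem J)
    rcases Int.natAbs_eq g with h | h
    · rw [h] at hg1
      simpa using hg1
    · rw [h] at hg1
      have h2 : (t * ((-(g.natAbs : ℤ) : ℤ) : ℂ) * Complex.I) =
          -(t * (g.natAbs : ℂ) * Complex.I) := by
        rw [Int.cast_neg, Int.cast_natCast, mul_neg, neg_mul]
      rw [h2, Complex.exp_neg, inv_eq_one] at hg1
      exact hg1

/-- Orthogonality of characters on one period `2π/d`. The shorter period is legitimate because only
multiples of `d` occur. -/
theorem intervalIntegral_exp_int_mul {d : ℕ} (hd : 0 < d) {m : ℤ} (hm : (d : ℤ) ∣ m) :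
    ∫ t in (-(Real.pi / d))..(Real.pi / d), Complex.exp (t * m * Complex.I) =
      if m = 0 then ((2 * Real.pi / d : ℝ) : ℂ) else 0 := by
  have hd' : (d : ℝ) ≠ 0 := by positivity
  have hd'' : (d : ℂ) ≠ 0 := by exact_mod_cast hd'
  split_ifs with h
  · subst h
    simp only [Int.cast_zero, mul_zero, zero_mul, Complex.exp_zero]
    rw [intervalIntegral.integral_const, sub_neg_eq_add, Complex.real_smul]
    push_cast
    ring
  · obtain ⟨j, rfl⟩ := hm
    have hc : (((d * j : ℤ) : ℂ) * Complex.I) ≠ 0 :=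
      mul_ne_zero (by exact_mod_cast h) Complex.I_ne_zero
    have h1 : ∀ t : ℝ, Complex.exp (t * ((d * j : ℤ) : ℂ) * Complex.I) =
        Complex.exp (((d * j : ℤ) : ℂ) * Complex.I * t) := fun t => by ring_nf
    simp_rw [h1]
    rw [integral_exp_mul_complex hc, div_eq_zero_iff]
    left
    rw [sub_eq_zero, Complex.exp_eq_exp_iff_exists_int]
    refine ⟨j, ?_⟩
    push_cast
    field_simp
    ring

/-- The characteristic function of a step of the Łukasiewicz walk. -/
noncomputable def stepChar (p : PMF ℕ) (t : ℝ) : ℂ :=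
  ∫ k : ℕ, Complex.exp (t * ((k : ℂ) - 1) * Complex.I) ∂p.toMeasure

instance (p : PMF ℕ) (n : ℕ) : IsProbabilityMeasure (iidDegrees p n) := by
  unfold iidDegrees; infer_instance

theorem stepChar_pow (p : PMF ℕ) (n : ℕ) (t : ℝ) :
    stepChar p t ^ n =
      ∫ x : Fin n → ℕ, Complex.exp (t * (((∑ i, x i : ℕ) : ℂ) - n) * Complex.I)
        ∂(iidDegrees p n) := by
  have := integral_fintype_prod_eq_prod (𝕜 := ℂ)
    (fun (_ : Fin n) (k : ℕ) => Complex.exp (t * ((k : ℂ) - 1) * Complex.I))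
    (μ := fun _ => p.toMeasure)
  rw [Finset.prod_const, Finset.card_univ, Fintype.card_fin] at this
  rw [stepChar, ← this, iidDegrees]
  congr with x
  rw [← Complex.exp_sum, ← Finset.sum_mul, ← Finset.mul_sum]
  simp

theorem norm_exp_mul_I (x : ℝ) (y : ℂ) (hy : y.im = 0) :
    ‖Complex.exp (x * y * Complex.I)‖ = 1 := by
  rw [Complex.norm_exp]
  simp [hy]

theorem ae_iidDegrees_ne_zero (p : PMF ℕ) (n : ℕ) :
    ∀ᵐ x ∂iidDegrees p n, ∀ i, p (x i) ≠ 0 := by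
  rw [ae_all_iff]
  intro i
  exact (Measure.quasiMeasurePreserving_eval (fun _ : Fin n => p.toMeasure) i).ae
    (ae_pmf_ne_zero p)

/-- Fourier inversion for the law of the sum of the degrees. -/
theorem iidDegrees_sum_eq (p : PMF ℕ) {d : ℕ} (hd : 0 < d) (hsupp : ∀ k, p k ≠ 0 → d ∣ k)
    (n a : ℕ) (ha : d ∣ a) :
    (((iidDegrees p n).real {x | ∑ i, x i = a} : ℝ) : ℂ) =
      (d / (2 * Real.pi) : ℝ) * ∫ t in (-(Real.pi / d))..(Real.pi / d),
        stepChar p t ^ n * Complex.exp (t * ((n : ℂ) - a) * Complex.I) := by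
  have hd' : (d : ℝ) ≠ 0 := by positivity
  have h1 : ∀ t : ℝ, stepChar p t ^ n * Complex.exp (t * ((n : ℂ) - a) * Complex.I) =
      ∫ x : Fin n → ℕ, Complex.exp (t * (((∑ i, x i : ℕ) : ℤ) - a : ℤ) * Complex.I)
        ∂(iidDegrees p n) := fun t => by
    rw [stepChar_pow, ← integral_mul_const]
    congr with x
    rw [← Complex.exp_add]
    congr 1
    push_cast
    ring
  simp_rw [h1]
  rw [intervalIntegral_integral_swap]
  · have h2 : ∀ᵐ x ∂iidDegrees p n,
        (∫ t in (-(Real.pi / d))..(Real.pi / d),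
          Complex.exp (t * (((∑ i, x i : ℕ) : ℤ) - a : ℤ) * Complex.I)) =
        ({x : Fin n → ℕ | ∑ i, x i = a}.indicator
          (fun _ => ((2 * Real.pi / d : ℝ) : ℂ))) x := by
      filter_upwards [ae_iidDegrees_ne_zero p n] with x hx
      have hdvd : (d : ℤ) ∣ ((∑ i, x i : ℕ) : ℤ) - a :=
        dvd_sub (Int.natCast_dvd_natCast.2 (Finset.dvd_sum fun i _ => hsupp _ (hx i)))
          (Int.natCast_dvd_natCast.2 ha)
      rw [intervalIntegral_exp_int_mul hd hdvd, Set.indicator_apply]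
      congr 1
      simp only [Set.mem_ofPred_eq, eq_iff_iff]
      omega
    rw [integral_congr_ae h2, integral_indicator_const _ (MeasurableSet.of_discrete),
      Complex.real_smul, mul_comm, mul_assoc, ← Complex.ofReal_mul,
      show 2 * Real.pi / d * (d / (2 * Real.pi)) = 1 by field_simp]
    simp
  · have : IsFiniteMeasure (volume.restrict (Set.uIoc (-(Real.pi / d)) (Real.pi / d))) :=
      ⟨by simp [Set.uIoc]⟩
    refine Integrable.of_bound (C := 1) ?_ (.of_forall fun z => ?_)
    · refine Measurable.aestronglyMeasurable ?_
      have : Measurable fun x : Fin n → ℕ => (((((∑ i, x i : ℕ) : ℤ) - a : ℤ)) : ℂ) :=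
        Measurable.of_discrete
      simp only [Function.uncurry_def]
      fun_prop
    · exact (norm_exp_mul_I _ _ (by simp)).le

/-! ### Decay of the characteristic function. -/

section LocalLimit

open Filter Topology

/-- The offspring distribution is critical with positive finite variance `s ^ 2`. -/
structure IsCriticalWith (p : PMF ℕ) (s : ℝ) : Prop where
  pos : 0 < s
  memLp : MemLp (fun k : ℕ => (k : ℝ)) 2 p.toMeasure
  mean : ∫ k : ℕ, (k : ℝ) ∂p.toMeasure = 1
  variance : Var[fun k : ℕ => (k : ℝ); p.toMeasure] = s ^ 2

theorem exists_isCriticalWith {p : PMF ℕ} (hmean : ∫ i : ℕ, (i : ℝ) ∂p.toMeasure = 1)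
    (hvar_pos : 0 < evariance (fun i : ℕ => (i : ℝ)) p.toMeasure)
    (hvar_lt : evariance (fun i : ℕ => (i : ℝ)) p.toMeasure < ∞) :
    ∃ s, IsCriticalWith p s := by
  have h2 : MemLp (fun k : ℕ => (k : ℝ)) 2 p.toMeasure :=
    (evariance_lt_top_iff_memLp (Measurable.of_discrete.aestronglyMeasurable)).1 hvar_lt
  have hpos : 0 < Var[fun k : ℕ => (k : ℝ); p.toMeasure] := by
    rw [ProbabilityTheory.variance]
    exact ENNReal.toReal_pos hvar_pos.ne' hvar_lt.ne
  exact ⟨√Var[fun k : ℕ => (k : ℝ); p.toMeasure], Real.sqrt_pos.2 hpos, h2, hmean,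
    (Real.sq_sqrt hpos.le).symm⟩

namespace IsCriticalWith

variable {p : PMF ℕ} {s : ℝ}

theorem integrable (h : IsCriticalWith p s) : Integrable (fun k : ℕ => (k : ℝ)) p.toMeasure :=
  h.memLp.integrable (by norm_num)

theorem integral_step (h : IsCriticalWith p s) :
    ∫ k : ℕ, ((k : ℝ) - 1) / s ∂p.toMeasure = 0 := by
  rw [integral_div, integral_sub h.integrable (integrable_const _), h.mean]
  simp

theorem integral_step_sq (h : IsCriticalWith p s) :
    ∫ k : ℕ, (((k : ℝ) - 1) / s) ^ 2 ∂p.toMeasure = 1 := by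
  have h1 := variance_eq_integral (μ := p.toMeasure) (X := fun k : ℕ => (k : ℝ))
    Measurable.of_discrete.aemeasurable
  rw [h.mean, h.variance] at h1
  simp_rw [div_pow]
  rw [integral_div, ← h1, div_self (pow_ne_zero _ h.pos.ne')]

theorem stepChar_eq (h : IsCriticalWith p s) (t : ℝ) :
    stepChar p t = charFun (p.toMeasure.map fun k : ℕ => ((k : ℝ) - 1) / s) (s * t) := by
  rw [charFun_apply_real, integral_map Measurable.of_discrete.aemeasurable, stepChar]
  · congr with k
    have : (s : ℂ) ≠ 0 := by exact_mod_cast h.pos.ne'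
    congr 1
    push_cast
    field_simp
  · exact Measurable.aestronglyMeasurable (by fun_prop)

theorem continuous_stepChar (h : IsCriticalWith p s) : Continuous (stepChar p) := by
  have := Measure.isProbabilityMeasure_map (μ := p.toMeasure)
    (f := fun k : ℕ => ((k : ℝ) - 1) / s) Measurable.of_discrete.aemeasurable
  have h1 : stepChar p = fun t =>
      charFun (p.toMeasure.map fun k : ℕ => ((k : ℝ) - 1) / s) (s * t) := funext h.stepChar_eq
  rw [h1]
  exact continuous_charFun.comp (by fun_prop)

theorem not_ae_one (h : IsCriticalWith p s) : ¬ ∀ k, p k ≠ 0 → k = 1 := by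
  intro hall
  have h1 : ∀ᵐ k : ℕ ∂p.toMeasure, (((k : ℝ) - 1) / s) ^ 2 = 0 := by
    rw [ae_pmf_iff]
    intro k hk
    simp [hall k hk]
  have h2 := h.integral_step_sq
  rw [integral_congr_ae h1] at h2
  simp at h2

/-- Otherwise the degree is at least one with mean one, hence almost surely one, against positive
variance. -/
theorem zero_mem (h : IsCriticalWith p s) : p 0 ≠ 0 := by
  intro h0
  apply h.not_ae_one
  have hnn : 0 ≤ᵐ[p.toMeasure] fun k : ℕ => (k : ℝ) - 1 := by
    have : ∀ᵐ k : ℕ ∂p.toMeasure, (0 : ℝ) ≤ (k : ℝ) - 1 := by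
      rw [ae_pmf_iff]
      intro k hk
      have : 1 ≤ k := Nat.one_le_iff_ne_zero.2 (by rintro rfl; exact hk h0)
      have : (1 : ℝ) ≤ k := by exact_mod_cast this
      linarith
    exact this
  have h1 : ∫ k : ℕ, ((k : ℝ) - 1) ∂p.toMeasure = 0 := by
    rw [integral_sub h.integrable (integrable_const _), h.mean]
    simp
  rw [integral_eq_zero_iff_of_nonneg_ae hnn (h.integrable.sub (integrable_const _))] at h1
  have h2 := ae_pmf_iff.1 h1
  intro k hk
  have h3 := h2 k hk
  simp only [Pi.zero_apply] at h3
  have : (k : ℝ) = 1 := by linarith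
  exact_mod_cast this

theorem exists_mem_support_ne_zero (h : IsCriticalWith p s) : ∃ k, k ≠ 0 ∧ p k ≠ 0 := by
  by_contra! hall
  have h1 : ∀ᵐ k : ℕ ∂p.toMeasure, (k : ℝ) = 0 := by
    rw [ae_pmf_iff]
    intro k hk
    have : k = 0 := by
      by_contra h0
      exact hk (hall k h0)
    simp [this]
  have h2 := h.mean
  rw [integral_congr_ae h1] at h2
  simp at h2

theorem norm_stepChar_le_one (p : PMF ℕ) (t : ℝ) : ‖stepChar p t‖ ≤ 1 := by
  have h := norm_integral_le_of_norm_le_const (μ := p.toMeasure) (C := 1)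
    (f := fun k : ℕ => Complex.exp (t * ((k : ℂ) - 1) * Complex.I))
    (.of_forall fun k => (norm_exp_mul_I _ _ (by simp)).le)
  simpa [stepChar] using h

/-- Where the characteristic function has modulus one, it is trivial on the support. -/
theorem exp_eq_one_of_norm_stepChar (h0 : p 0 ≠ 0) {t : ℝ} (ht : ‖stepChar p t‖ = 1) (k : ℕ)
    (hk : p k ≠ 0) : Complex.exp (t * k * Complex.I) = 1 := by
  set w := stepChar p t with hw
  set f : ℕ → ℂ := fun k => Complex.exp (t * ((k : ℂ) - 1) * Complex.I) with hf
  have hfn : ∀ k, ‖f k‖ = 1 := fun k => norm_exp_mul_I _ _ (by simp)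
  have hfi : Integrable f p.toMeasure :=
    Integrable.of_bound Measurable.of_discrete.aestronglyMeasurable 1
      (.of_forall fun k => (hfn k).le)
  have hww : w * starRingEnd ℂ w = 1 := by
    rw [Complex.mul_conj, Complex.normSq_eq_norm_sq, ht]; simp
  have hn : ∀ k, ‖f k * starRingEnd ℂ w‖ = 1 := fun k => by
    rw [norm_mul, hfn, Complex.norm_conj, ht, one_mul]
  have hgi : Integrable (fun k => f k * starRingEnd ℂ w) p.toMeasure := hfi.mul_const _
  have hgr : Integrable (fun k => (f k * starRingEnd ℂ w).re) p.toMeasure := hgi.re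
  -- Equality case of the triangle inequality: unit complex numbers whose mean `w` has modulus one
  -- are almost surely equal to `w`.
  have hint : ∫ k, (1 - (f k * starRingEnd ℂ w).re) ∂p.toMeasure = 0 := by
    rw [integral_sub (integrable_const _) hgr]
    have h1 : ∫ k, (f k * starRingEnd ℂ w).re ∂p.toMeasure =
        (∫ k, f k * starRingEnd ℂ w ∂p.toMeasure).re := integral_re hgi
    rw [h1, integral_mul_const, ← stepChar, ← hw, hww]
    simp
  have hnn : 0 ≤ fun k => 1 - (f k * starRingEnd ℂ w).re := fun k => by
    have := (Complex.re_le_norm (f k * starRingEnd ℂ w)).trans (hn k).le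
    simpa using this
  rw [integral_eq_zero_iff_of_nonneg hnn ((integrable_const _).sub hgr)] at hint
  have hall := ae_pmf_iff.1 hint
  have hfw : ∀ k, p k ≠ 0 → f k = w := fun k hk => by
    have h1 := hall k hk
    simp only [Pi.zero_apply] at h1
    have h2 : (f k * starRingEnd ℂ w).re = 1 := by linarith
    have h3 : f k * starRingEnd ℂ w = 1 := by
      have h4 : (f k * starRingEnd ℂ w).re = ‖f k * starRingEnd ℂ w‖ := by rw [h2, hn]
      rw [Complex.re_eq_norm] at h4
      apply Complex.ext
      · simpa using h2
      · simpa using (Complex.nonneg_iff.1 h4).2.symm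
    calc f k = f k * (w * starRingEnd ℂ w) := by rw [hww, mul_one]
      _ = w * (f k * starRingEnd ℂ w) := by ring
      _ = w := by rw [h3, mul_one]
  have h5 : f k = f 0 := by rw [hfw k hk, hfw 0 h0]
  -- Comparing with the atom at `0` removes the shift by one in the steps.
  have h6 : Complex.exp (t * k * Complex.I) * f 0 = f k := by
    rw [hf]
    simp only
    rw [← Complex.exp_add]
    congr 1
    push_cast
    ring
  rw [h5] at h6
  exact mul_right_cancel₀ (b := f 0) (by rw [hf]; exact Complex.exp_ne_zero _) (by rw [h6, one_mul])

/-- Modulus one would force `t * d` to be a multiple of `2π`, and the only one within `[-π, π]` is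
`0`. -/
theorem norm_stepChar_lt_one (h0 : p 0 ≠ 0) {d : ℕ} (hd : 0 < d)
    (hspan : ∀ t : ℝ, (∀ k : ℕ, p k ≠ 0 → Complex.exp (t * k * Complex.I) = 1) →
        Complex.exp (t * d * Complex.I) = 1) {t : ℝ} (ht0 : t ≠ 0) (ht : |t| ≤ Real.pi / d) :
    ‖stepChar p t‖ < 1 := by
  refine lt_of_le_of_ne (norm_stepChar_le_one p t) fun h1 => ?_
  have h2 := hspan t (exp_eq_one_of_norm_stepChar h0 h1)
  rw [Complex.exp_eq_one_iff] at h2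
  obtain ⟨n, hn⟩ := h2
  have hd' : (0 : ℝ) < d := by exact_mod_cast hd
  have h3 : t * d = n * (2 * Real.pi) := by
    have h4 : ((t * d : ℝ) : ℂ) * Complex.I = ((n * (2 * Real.pi) : ℝ) : ℂ) * Complex.I := by
      push_cast
      rw [hn]
      ring
    exact_mod_cast mul_right_cancel₀ Complex.I_ne_zero h4
  have h5 : |t * d| ≤ Real.pi := by
    rw [abs_mul, abs_of_pos hd']
    rwa [le_div_iff₀ hd'] at ht
  have hn0 : n ≠ 0 := by
    rintro rfl
    simp at h3
    rcases h3 with h3 | h3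
    · exact ht0 h3
    · omega
  have h6 : (1 : ℝ) ≤ |(n : ℝ)| := by exact_mod_cast Int.one_le_abs hn0
  rw [h3, abs_mul, abs_of_pos (by positivity : (0 : ℝ) < 2 * Real.pi)] at h5
  nlinarith [Real.pi_pos]

/-- Gaussian decay of the characteristic function on a period. -/
theorem exists_norm_stepChar_le (h : IsCriticalWith p s) {d : ℕ} (hd : 0 < d)
    (hspan : ∀ t : ℝ, (∀ k : ℕ, p k ≠ 0 → Complex.exp (t * k * Complex.I) = 1) →
        Complex.exp (t * d * Complex.I) = 1) :
    ∃ c : ℝ, 0 < c ∧ ∀ t : ℝ, |t| ≤ Real.pi / d → ‖stepChar p t‖ ≤ Real.exp (-c * t ^ 2) := by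
  have hT := taylor_charFun_two (P := p.toMeasure) (X := fun k : ℕ => ((k : ℝ) - 1) / s)
    Measurable.of_discrete.aemeasurable h.integral_step
    (by simpa using h.integral_step_sq)
  -- An error of `u²/4`, where `u = s t`, leaves half of the quadratic term in `1 - u²/2`. The bound
  -- `|u| ≤ 1` imposed below keeps that quantity nonnegative.
  have hT' := hT.def (show (0 : ℝ) < 1 / 4 by norm_num)
  rw [Metric.eventually_nhds_iff] at hT'
  obtain ⟨ε, hε, hT'⟩ := hT'
  have hs := h.pos
  set δ := min (ε / 2) 1 / s with hδ
  have hδpos : 0 < δ := by positivity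
  have hnear : ∀ t : ℝ, |t| ≤ δ → ‖stepChar p t‖ ≤ 1 - (s ^ 2 / 4) * t ^ 2 := fun t ht => by
    have h1 : |s * t| ≤ min (ε / 2) 1 := by
      rw [abs_mul, abs_of_pos hs]
      calc s * |t| ≤ s * δ := by gcongr
        _ = min (ε / 2) 1 := by rw [hδ]; field_simp
    have h2 : |s * t| < ε := (h1.trans (min_le_left _ _)).trans_lt (by linarith)
    have h3 : |s * t| ≤ 1 := h1.trans (min_le_right _ _)
    have h4 : (s * t) ^ 2 ≤ 1 := by
      rw [← sq_abs]; exact pow_le_one₀ (abs_nonneg _) h3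
    have h5 := hT' (y := s * t) (by simpa using h2)
    rw [← h.stepChar_eq] at h5
    have h6 : ‖(1 - ((s * t : ℝ) : ℂ) ^ 2 / 2)‖ = 1 - (s * t) ^ 2 / 2 := by
      have : (1 - ((s * t : ℝ) : ℂ) ^ 2 / 2) = ((1 - (s * t) ^ 2 / 2 : ℝ) : ℂ) := by push_cast; rfl
      rw [this, Complex.norm_real, Real.norm_of_nonneg (by linarith)]
    have h7 := norm_sub_norm_le (stepChar p t) (1 - ((s * t : ℝ) : ℂ) ^ 2 / 2)
    rw [Real.norm_of_nonneg (sq_nonneg _)] at h5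
    rw [h6] at h7
    have h8 := h7.trans h5
    nlinarith
  -- Away from zero, `(1 - ‖stepChar p t‖) / t ^ 2` is continuous and positive on a compact set, so
  -- its minimum serves as `c`.
  have hfar : ∃ c : ℝ, 0 < c ∧ ∀ t : ℝ, δ ≤ |t| → |t| ≤ Real.pi / d →
      ‖stepChar p t‖ ≤ 1 - c * t ^ 2 := by
    set K : Set ℝ := {t | δ ≤ |t| ∧ |t| ≤ Real.pi / d} with hK
    have hKc : IsCompact K := by
      refine Metric.isCompact_of_isClosed_isBounded ?_ ?_
      · exact (isClosed_le continuous_const continuous_abs).inter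
          (isClosed_le continuous_abs continuous_const)
      · refine (Metric.isBounded_closedBall (x := (0 : ℝ)) (r := Real.pi / d)).subset ?_
        intro t ht
        simpa using ht.2
    have hK0 : ∀ t ∈ K, t ≠ 0 := fun t ht h0 => by
      have := ht.1
      rw [h0, abs_zero] at this
      linarith
    rcases K.eq_empty_or_nonempty with hKe | hKne
    · refine ⟨1, one_pos, fun t h1 h2 => ?_⟩
      have : t ∈ K := ⟨h1, h2⟩
      rw [hKe] at this
      exact this.elim
    · obtain ⟨t₀, ht₀, hmin⟩ := hKc.exists_isMinOn hKne
        (f := fun t => (1 - ‖stepChar p t‖) / t ^ 2)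
        (ContinuousOn.div (by have := h.continuous_stepChar; fun_prop) (by fun_prop)
          fun t ht => pow_ne_zero _ (hK0 t ht))
      have hlt := norm_stepChar_lt_one h.zero_mem hd hspan (hK0 _ ht₀) ht₀.2
      have ht0 := hK0 _ ht₀
      refine ⟨(1 - ‖stepChar p t₀‖) / t₀ ^ 2, div_pos (by linarith) (by positivity), ?_⟩
      intro t h1 h2
      have h3 := hmin (show t ∈ K from ⟨h1, h2⟩)
      simp only [Set.mem_ofPred_eq] at h3
      have h4 : 0 < t ^ 2 := by
        have := hK0 t ⟨h1, h2⟩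
        positivity
      rw [le_div_iff₀ h4] at h3
      linarith
  obtain ⟨c, hc, hfar⟩ := hfar
  refine ⟨min c (s ^ 2 / 4), by positivity, fun t ht => ?_⟩
  have hsq := sq_nonneg t
  have : ‖stepChar p t‖ ≤ 1 - min c (s ^ 2 / 4) * t ^ 2 := by
    rcases le_total |t| δ with h1 | h1
    · have := hnear t h1
      have := mul_le_mul_of_nonneg_right (min_le_right c (s ^ 2 / 4)) hsq
      linarith
    · have := hfar t h1 ht
      have := mul_le_mul_of_nonneg_right (min_le_left c (s ^ 2 / 4)) hsq
      linarith
  refine this.trans ?_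
  have := Real.one_sub_le_exp_neg (min c (s ^ 2 / 4) * t ^ 2)
  rwa [neg_mul]

end IsCriticalWith

end LocalLimit

/-! ### Local limit estimates for the sum of the degrees. -/

section LocalLimit

open Filter Topology

namespace IsCriticalWith

variable {p : PMF ℕ} {s : ℝ}

theorem iidDegrees_sum_eq_zero {d : ℕ} (hsupp : ∀ k, p k ≠ 0 → d ∣ k) (n : ℕ) {a : ℕ}
    (ha : ¬ d ∣ a) : (iidDegrees p n).real {x | ∑ i, x i = a} = 0 := by
  rw [measureReal_def, measure_mono_null (t := {x | ¬ ∀ i, p (x i) ≠ 0}) ?_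
    (ae_iff.1 (ae_iidDegrees_ne_zero p n))]
  · simp
  · intro x hx hall
    refine ha ?_
    rw [← (show ∑ i, x i = a from hx)]
    exact Finset.dvd_sum fun i _ => hsupp _ (hall i)

/-- The largest atom of the sum of `n` degrees has order at most `1 / √n`. -/
theorem exists_iidDegrees_sum_le (h : IsCriticalWith p s) :
    ∃ C : ℝ, 0 < C ∧ ∀ n a : ℕ,
      (iidDegrees p n).real {x | ∑ i, x i = a} ≤ C / √((n : ℝ) + 1) := by
  obtain ⟨k₀, hk₀, hpk₀⟩ := h.exists_mem_support_ne_zero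
  obtain ⟨d, hd, hsupp, hspan⟩ := exists_span hk₀ hpk₀
  obtain ⟨c, hc, hdecay⟩ := h.exists_norm_stepChar_le hd hspan
  set K : ℝ := d / (2 * Real.pi) * √(Real.pi / c) with hK
  have hK0 : 0 ≤ K := by positivity
  -- The `1` covers `n = 0`; the `√2` turns `√n` into `√(n+1)` for `n ≥ 1`.
  refine ⟨1 + √2 * K, by positivity, fun n a => ?_⟩
  by_cases ha : d ∣ a
  swap
  · rw [iidDegrees_sum_eq_zero hsupp n ha]
    positivity
  rcases Nat.eq_zero_or_pos n with rfl | hn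
  · refine measureReal_le_one.trans ?_
    simp
    positivity
  have hn' : (0 : ℝ) < n := by exact_mod_cast hn
  have h1 := iidDegrees_sum_eq p hd hsupp n a ha
  have h2 : (iidDegrees p n).real {x | ∑ i, x i = a} ≤ K / √n := by
    have hle : -(Real.pi / d) ≤ Real.pi / d := by
      have : 0 ≤ Real.pi / d := by positivity
      linarith
    have h3 : ‖∫ t in (-(Real.pi / d))..(Real.pi / d),
        stepChar p t ^ n * Complex.exp (t * ((n : ℂ) - a) * Complex.I)‖ ≤
        √(Real.pi / (c * n)) := by
      have hb : ∀ t ∈ Set.Ioc (-(Real.pi / d)) (Real.pi / d),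
          ‖stepChar p t ^ n * Complex.exp (t * ((n : ℂ) - a) * Complex.I)‖ ≤
            Real.exp (-(c * n) * t ^ 2) := fun t ht => by
        rw [norm_mul, norm_exp_mul_I _ _ (by simp), mul_one, norm_pow]
        calc ‖stepChar p t‖ ^ n ≤ Real.exp (-c * t ^ 2) ^ n := by
              gcongr
              exact hdecay t (abs_le.2 ⟨ht.1.le, ht.2⟩)
          _ = Real.exp (-(c * n) * t ^ 2) := by
              rw [← Real.exp_nat_mul]
              congr 1
              ring
      have hint := integrable_exp_neg_mul_sq (b := c * n) (by positivity)
      refine (intervalIntegral.norm_integral_le_of_norm_le hle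
        (ae_of_all _ hb) hint.intervalIntegrable).trans ?_
      rw [intervalIntegral.integral_of_le hle, ← integral_gaussian]
      exact setIntegral_le_integral hint (ae_of_all _ fun t => (Real.exp_pos _).le)
    have h4 : ‖(((iidDegrees p n).real {x | ∑ i, x i = a} : ℝ) : ℂ)‖ ≤
        d / (2 * Real.pi) * √(Real.pi / (c * n)) := by
      rw [h1, norm_mul, Complex.norm_real, Real.norm_of_nonneg (by positivity)]
      gcongr
    rw [Complex.norm_real, Real.norm_of_nonneg measureReal_nonneg] at h4
    refine h4.trans_eq ?_
    rw [hK, ← div_div Real.pi, Real.sqrt_div' _ hn'.le]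
    ring
  refine h2.trans ?_
  rw [div_le_div_iff₀ (by positivity) (by positivity)]
  have h5 : √((n : ℝ) + 1) ≤ √2 * √n := by
    rw [← Real.sqrt_mul (by norm_num)]
    apply Real.sqrt_le_sqrt
    have : (1 : ℝ) ≤ n := by exact_mod_cast hn
    linarith
  calc K * √((n : ℝ) + 1) ≤ K * (√2 * √n) := by gcongr
    _ ≤ (1 + √2 * K) * √n := by nlinarith [Real.sqrt_nonneg n]

theorem tendsto_stepChar_pow (h : IsCriticalWith p s) (t : ℝ) :
    Tendsto (fun n : ℕ => stepChar p (t * (√n)⁻¹) ^ n) atTop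
      (𝓝 (Complex.exp (-((s * t : ℝ) : ℂ) ^ 2 / 2))) := by
  have h1 := tendsto_charFun_inv_sqrt_mul_pow (P := p.toMeasure)
    (X := fun k : ℕ => ((k : ℝ) - 1) / s) Measurable.of_discrete.aemeasurable h.integral_step
    (by simpa using h.integral_step_sq) (s * t)
  refine h1.congr fun n => ?_
  rw [h.stepChar_eq]
  congr 2
  ring

/-- The local limit theorem at `n - 1`. -/
theorem tendsto_sqrt_mul_integral (h : IsCriticalWith p s) {d : ℕ} (hd : 0 < d)
    (hspan : ∀ t : ℝ, (∀ k : ℕ, p k ≠ 0 → Complex.exp (t * k * Complex.I) = 1) →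
        Complex.exp (t * d * Complex.I) = 1) :
    Tendsto (fun n : ℕ => (√n : ℂ) * ∫ t in (-(Real.pi / d))..(Real.pi / d),
        stepChar p t ^ n * Complex.exp (t * Complex.I)) atTop
      (𝓝 ((√(Real.pi / (s ^ 2 / 2)) : ℝ) : ℂ)) := by
  obtain ⟨c, hc, hdecay⟩ := h.exists_norm_stepChar_le hd hspan
  set R : ℝ := Real.pi / d with hR
  have hRpos : 0 < R := by positivity
  set G : ℕ → ℝ → ℂ := fun n t => stepChar p (t * (√n)⁻¹) ^ n *
    Complex.exp ((t * (√n)⁻¹ : ℝ) * Complex.I) with hG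
  set F : ℕ → ℝ → ℂ := fun n => (Set.Ioc (-(R * √n)) (R * √n)).indicator (G n) with hF
  have hcont := h.continuous_stepChar
  have hGc : ∀ n, Continuous (G n) := fun n => by
    rw [hG]
    fun_prop
  -- Substituting `t / √n` absorbs the factor `√n`; the Gaussian decay then dominates the integrands
  -- on the growing windows.
  have hEq : ∀ᶠ n : ℕ in atTop, ∫ t, F n t = (√n : ℂ) *
      ∫ t in (-R)..R, stepChar p t ^ n * Complex.exp (t * Complex.I) := by
    filter_upwards [eventually_gt_atTop 0] with n hn
    have hn' : 0 < √(n : ℝ) := Real.sqrt_pos.2 (by exact_mod_cast hn)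
    rw [hF]
    simp only
    rw [integral_indicator measurableSet_Ioc, ← intervalIntegral.integral_of_le (by nlinarith)]
    have := intervalIntegral.integral_comp_mul_right (a := -(R * √n)) (b := R * √n)
      (fun t : ℝ => stepChar p t ^ n * Complex.exp (t * Complex.I)) (inv_ne_zero hn'.ne')
    rw [hG]
    simp only
    rw [this, inv_inv, neg_mul, mul_inv_cancel_right₀ hn'.ne', Complex.real_smul]
  refine Tendsto.congr' hEq ?_
  have hgauss : ((√(Real.pi / (s ^ 2 / 2)) : ℝ) : ℂ) =
      ∫ t : ℝ, Complex.exp (-((s * t : ℝ) : ℂ) ^ 2 / 2) := by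
    rw [← integral_gaussian, ← integral_complex_ofReal]
    congr with t
    rw [Complex.ofReal_exp]
    congr 1
    push_cast
    ring
  rw [hgauss]
  refine tendsto_integral_of_dominated_convergence (fun t => Real.exp (-c * t ^ 2))
    (fun n => ((hGc n).aestronglyMeasurable.indicator measurableSet_Ioc))
    (integrable_exp_neg_mul_sq hc) (fun n => ae_of_all _ fun t => ?_) (ae_of_all _ fun t => ?_)
  · rw [hF]
    simp only
    rw [Set.indicator_apply]
    split_ifs with ht
    · have hn' : 0 < √(n : ℝ) := by
        by_contra hle
        have h0 : √(n : ℝ) = 0 := le_antisymm (not_lt.1 hle) (Real.sqrt_nonneg _)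
        rw [h0] at ht
        simp at ht
      have hsq : √(n : ℝ) ^ 2 = n := Real.sq_sqrt (by positivity)
      rw [hG]
      simp only
      rw [norm_mul, Complex.norm_exp_ofReal_mul_I, mul_one, norm_pow]
      calc ‖stepChar p (t * (√n)⁻¹)‖ ^ n ≤ Real.exp (-c * (t * (√n)⁻¹) ^ 2) ^ n := by
            gcongr
            apply hdecay
            rw [abs_mul, abs_of_pos (inv_pos.2 hn'), ← div_eq_mul_inv, div_le_iff₀ hn']
            exact abs_le.2 ⟨ht.1.le, ht.2⟩
        _ = Real.exp (-c * t ^ 2) := by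
            rw [← Real.exp_nat_mul]
            congr 1
            rw [mul_pow, inv_pow, hsq]
            have : (n : ℝ) ≠ 0 := by rw [← hsq]; positivity
            field_simp
    · simp [(Real.exp_pos _).le]
  · have hsqrt : Tendsto (fun n : ℕ => √(n : ℝ)) atTop atTop :=
      Real.tendsto_sqrt_atTop.comp tendsto_natCast_atTop_atTop
    have h1 : ∀ᶠ n : ℕ in atTop, G n t = F n t := by
      filter_upwards [hsqrt.eventually_gt_atTop (|t| / R)] with n hn
      rw [div_lt_iff₀ hRpos] at hn
      rw [hF]
      simp only
      rw [Set.indicator_of_mem]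
      have := abs_lt.1 hn
      constructor <;> nlinarith [this.1, this.2]
    refine Tendsto.congr' h1 ?_
    rw [hG]
    simp only
    have h2 : Tendsto (fun n : ℕ => Complex.exp ((t * (√n)⁻¹ : ℝ) * Complex.I)) atTop (𝓝 1) := by
      have h3 : Tendsto (fun n : ℕ => t * (√(n : ℝ))⁻¹) atTop (𝓝 0) := by
        simpa using (tendsto_inv_atTop_zero.comp hsqrt).const_mul t
      have h4 : Continuous fun u : ℝ => Complex.exp (u * Complex.I) := by fun_prop
      have h5 := (h4.tendsto 0).comp h3
      rw [Complex.ofReal_zero, zero_mul, Complex.exp_zero] at h5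
      exact h5
    simpa using (h.tendsto_stepChar_pow t).mul h2

/-- The probability that the sum of `n` degrees is `n - 1` has order at least `1 / √n`,
unless it vanishes. -/
theorem exists_le_iidDegrees_sum (h : IsCriticalWith p s) :
    ∃ c : ℝ, 0 < c ∧ ∀ n : ℕ, 0 < n → (iidDegrees p n).real {x | ∑ i, x i = n - 1} ≠ 0 →
      c ≤ √n * (iidDegrees p n).real {x | ∑ i, x i = n - 1} := by
  obtain ⟨k₀, hk₀, hpk₀⟩ := h.exists_mem_support_ne_zero
  obtain ⟨d, hd, hsupp, hspan⟩ := exists_span hk₀ hpk₀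
  have hs := h.pos
  set L : ℝ := √(Real.pi / (s ^ 2 / 2)) with hL
  have hLpos : 0 < L := by positivity
  have hT := (h.tendsto_sqrt_mul_integral hd hspan).norm
  rw [Complex.norm_real, Real.norm_of_nonneg hLpos.le] at hT
  have hev := hT.eventually (lt_mem_nhds (show L / 2 < L by linarith))
  obtain ⟨N, hN⟩ := eventually_atTop.1 hev
  set f : ℕ → ℝ := fun n => √n * (iidDegrees p n).real {x | ∑ i, x i = n - 1} with hf
  -- The limit controls only `n ≥ N`; below `N` take the least positive value.
  obtain ⟨c, hc, hsmall⟩ : ∃ c : ℝ, 0 < c ∧ ∀ n < N, 0 < f n → c ≤ f n := by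
    clear hN
    induction N with
    | zero => exact ⟨1, one_pos, fun n hn => absurd hn (Nat.not_lt_zero n)⟩
    | succ N ih =>
      obtain ⟨c, hc, ih⟩ := ih
      rcases le_or_gt (f N) 0 with hfN | hfN
      · refine ⟨c, hc, fun n hn hpos => ?_⟩
        rcases Nat.lt_succ_iff_lt_or_eq.1 hn with h1 | rfl
        · exact ih n h1 hpos
        · linarith
      · refine ⟨min c (f N), lt_min hc hfN, fun n hn hpos => ?_⟩
        rcases Nat.lt_succ_iff_lt_or_eq.1 hn with h1 | rfl
        · exact (min_le_left _ _).trans (ih n h1 hpos)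
        · exact min_le_right _ _
  refine ⟨min c (d / (2 * Real.pi) * (L / 2)), by positivity, fun n hn hne => ?_⟩
  have hn' : (0 : ℝ) < n := by exact_mod_cast hn
  rcases lt_or_ge n N with hlt | hge
  · refine (min_le_left _ _).trans (hsmall n hlt ?_)
    exact mul_pos (Real.sqrt_pos.2 hn') (lt_of_le_of_ne measureReal_nonneg hne.symm)
  · refine (min_le_right _ _).trans ?_
    have hdvd : d ∣ n - 1 := by
      by_contra hnd
      exact hne (iidDegrees_sum_eq_zero hsupp n hnd)
    have h1 := iidDegrees_sum_eq p hd hsupp n (n - 1) hdvd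
    have h2 : ∀ t : ℝ, Complex.exp (t * ((n : ℂ) - (n - 1 : ℕ)) * Complex.I) =
        Complex.exp (t * Complex.I) := fun t => by
      rw [Nat.cast_sub hn]
      congr 1
      push_cast
      ring
    simp_rw [h2] at h1
    have h3 := congrArg norm h1
    rw [Complex.norm_real, Real.norm_of_nonneg measureReal_nonneg, norm_mul, Complex.norm_real,
      Real.norm_of_nonneg (by positivity)] at h3
    have h4 := hN n hge
    rw [norm_mul, Complex.norm_real, Real.norm_of_nonneg (Real.sqrt_nonneg _)] at h4
    rw [h3, mul_left_comm]
    gcongr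

end IsCriticalWith

end LocalLimit

/-! ### Masses of trees and forests as sums over degree sequences. -/

section Masses

/-- The probability that independent degrees start with the given list. -/
noncomputable def listWeight (p : PMF ℕ) (l : List ℕ) : ℝ≥0∞ := (l.map p).prod

@[simp] theorem listWeight_nil (p : PMF ℕ) : listWeight p [] = 1 := rfl

@[simp] theorem listWeight_cons (p : PMF ℕ) (a : ℕ) (l : List ℕ) :
    listWeight p (a :: l) = p a * listWeight p l := by
  simp [listWeight]

@[simp] theorem listWeight_append (p : PMF ℕ) (l m : List ℕ) :
    listWeight p (l ++ m) = listWeight p l * listWeight p m := by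
  simp [listWeight]

theorem listWeight_rotate (p : PMF ℕ) (l : List ℕ) (k : ℕ) :
    listWeight p (l.rotate k) = listWeight p l :=
  ((l.rotate_perm k).map p).prod_eq

theorem weight_eq_listWeight (p : PMF ℕ) (t : PlaneTree) :
    t.weight p = listWeight p t.degrees := by
  induction t using PlaneTree.induction_children with
  | h cs ih =>
    rw [PlaneTree.weight, PlaneTree.degrees_node, listWeight_cons]
    congr 1
    induction cs with
    | nil => simp
    | cons c cs ihc =>
      rw [List.map_cons, List.prod_cons, ih c (by simp), ihc fun c' hc' => ih c' (by simp [hc'])]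
      simp

theorem iidDegrees_apply (p : PMF ℕ) (n : ℕ) (A : Set (List ℕ)) :
    iidDegrees p n {x | List.ofFn x ∈ A} =
      ∑' l, (A ∩ {l | l.length = n}).indicator (listWeight p) l := by
  classical
  rw [← Measure.tsum_indicator_apply_singleton _ _ MeasurableSet.of_discrete]
  have hinj : Function.Injective (List.ofFn : (Fin n → ℕ) → List ℕ) := List.ofFn_injective
  rw [← hinj.tsum_eq]
  · refine tsum_congr fun x => ?_
    rw [Set.indicator_apply, Set.indicator_apply]
    simp only [Set.mem_ofPred_eq, Set.mem_inter_iff, List.length_ofFn, and_true]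
    congr 1
    rw [iidDegrees, Measure.pi_singleton, listWeight, List.map_ofFn, List.prod_ofFn]
    simp [PMF.toMeasure_apply_singleton]
  · intro l hl
    have := Set.mem_of_indicator_ne_zero hl
    obtain ⟨-, rfl⟩ := this
    exact ⟨l.get, List.ofFn_get l⟩

theorem galtonWatson_apply (p : PMF ℕ) (A : Set PlaneTree) :
    galtonWatson p A = ∑' t, A.indicator (PlaneTree.weight p) t := by
  have hA : MeasurableSet A := MeasurableSpace.measurableSet_top
  rw [galtonWatson, Measure.sum_apply _ hA]
  refine tsum_congr fun t => ?_
  rw [Measure.smul_apply, Measure.dirac_apply' _ hA, smul_eq_mul]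
  by_cases h : t ∈ A <;> simp [h]

theorem iidDegrees_rotate (p : PMF ℕ) (n k : ℕ) (A : Set (List ℕ)) :
    iidDegrees p n {x | (List.ofFn x).rotate k ∈ A} = iidDegrees p n {x | List.ofFn x ∈ A} := by
  classical
  rw [iidDegrees_apply p n A]
  have h := iidDegrees_apply p n {l | l.rotate k ∈ A}
  simp only [Set.mem_ofPred_eq] at h
  rw [h, ← (List.rotate_injective k).tsum_eq (f := (A ∩ {l | l.length = n}).indicator _)]
  · refine tsum_congr fun l => ?_
    rw [Set.indicator_apply, Set.indicator_apply, listWeight_rotate]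
    simp
  · intro l _
    exact ⟨_, (List.rotate_eq_iff.2 rfl)⟩

theorem galtonWatson_size_eq (p : PMF ℕ) (n : ℕ) :
    galtonWatson p {t | t.size = n} =
      iidDegrees p n {x | List.ofFn x ∈ Set.range PlaneTree.degrees} := by
  classical
  rw [galtonWatson_apply, iidDegrees_apply, ← PlaneTree.degrees_injective.tsum_eq]
  · refine tsum_congr fun t => ?_
    rw [Set.indicator_apply, Set.indicator_apply, weight_eq_listWeight]
    simp [PlaneTree.length_degrees]
  · intro l hl
    exact (Set.mem_of_indicator_ne_zero hl).1

theorem excess_ofFn {n : ℕ} (x : Fin n → ℕ) :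
    PlaneTree.excess (List.ofFn x) = ((∑ i, x i : ℕ) : ℤ) - n := by
  rw [PlaneTree.excess, List.sum_ofFn, List.length_ofFn]

theorem galtonWatson_size_le_sum (p : PMF ℕ) {n : ℕ} :
    galtonWatson p {t | t.size = n} ≤ iidDegrees p n {x | ∑ i, x i = n - 1} := by
  rw [galtonWatson_size_eq]
  refine measure_mono fun x hx => ?_
  obtain ⟨t, ht⟩ := hx
  have h1 := PlaneTree.excess_degrees t
  rw [ht, excess_ofFn] at h1
  simp only [Set.mem_ofPred_eq]
  omega

/-- Union bound over the `n` rotations: by the cycle lemma at least one of them codes a tree, and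
all have the same law. -/
theorem sum_le_galtonWatson_size (p : PMF ℕ) {n : ℕ} (hn : 0 < n) :
    iidDegrees p n {x | ∑ i, x i = n - 1} ≤ n * galtonWatson p {t | t.size = n} := by
  rw [galtonWatson_size_eq]
  calc iidDegrees p n {x | ∑ i, x i = n - 1}
      ≤ iidDegrees p n (⋃ k ∈ Finset.range n,
          {x | (List.ofFn x).rotate k ∈ Set.range PlaneTree.degrees}) := by
        refine measure_mono fun x hx => ?_
        have hx' : ∑ i, x i = n - 1 := hx
        obtain ⟨k, hk, t, ht⟩ := PlaneTree.exists_rotate_eq_degrees (List.ofFn x)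
          (by rw [excess_ofFn, hx']; omega)
        simp only [Set.mem_iUnion]
        exact ⟨k, by simpa using hk, t, ht⟩
    _ ≤ ∑ k ∈ Finset.range n, iidDegrees p n
          {x | (List.ofFn x).rotate k ∈ Set.range PlaneTree.degrees} :=
        measure_biUnion_finset_le _ _
    _ = _ := by
        simp_rw [iidDegrees_rotate]
        simp

/-- Complete the code of a tree of size at most `n` by arbitrary degrees up to length `n`. The
completions have total weight one, and distinct pairs give distinct sequences. -/
theorem galtonWatson_le_firstTreeHS (p : PMF ℕ) (n h : ℕ) :
    galtonWatson p {t | t.size ≤ n ∧ h ≤ t.hs} ≤ iidDegrees p n {x | h ≤ firstTreeHS x} := by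
  set A : Set (List ℕ) := {l | ∃ t : PlaneTree, t.degrees <+: l ∧ h ≤ t.hs} with hA
  have h1 : iidDegrees p n {x | List.ofFn x ∈ A} ≤ iidDegrees p n {x | h ≤ firstTreeHS x} := by
    refine measure_mono fun x hx => ?_
    obtain ⟨t, ht, hth⟩ := hx
    have hex : ∃ t : PlaneTree, t.degrees <+: List.ofFn x := ⟨t, ht⟩
    simp only [Set.mem_ofPred_eq]
    rw [firstTreeHS, dif_pos hex, PlaneTree.eq_of_degrees_prefix hex.choose_spec ht]
    exact hth
  refine le_trans ?_ h1
  have hone : ∀ m, ∑' l, {l : List ℕ | l.length = m}.indicator (listWeight p) l = 1 := fun m => by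
    have h2 := iidDegrees_apply p m Set.univ
    rw [Set.univ_inter] at h2
    rw [← h2]
    simp
  rw [galtonWatson_apply, iidDegrees_apply]
  have hinj : Function.Injective fun z : PlaneTree × List ℕ => z.1.degrees ++ z.2 := by
    rintro ⟨s, l⟩ ⟨t, m⟩ hst
    obtain ⟨rfl, rfl⟩ := PlaneTree.eq_of_degrees_append s t l m hst
    rfl
  refine le_trans ?_ (ENNReal.tsum_comp_le_tsum_of_injective hinj _)
  rw [ENNReal.tsum_prod']
  refine ENNReal.tsum_le_tsum fun t => ?_
  by_cases ht : t.size ≤ n ∧ h ≤ t.hs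
  · rw [Set.indicator_of_mem (by exact ht), ← mul_one (PlaneTree.weight p t), ← hone (n - t.size),
      ← ENNReal.tsum_mul_left]
    refine ENNReal.tsum_le_tsum fun l => ?_
    by_cases hl : l.length = n - t.size
    · rw [Set.indicator_of_mem (by exact hl), Set.indicator_of_mem, listWeight_append,
        weight_eq_listWeight]
      refine ⟨⟨t, List.prefix_append _ _, ht.2⟩, ?_⟩
      simp only [Set.mem_ofPred_eq, List.length_append, PlaneTree.length_degrees]
      omega
    · rw [Set.indicator_of_notMem (by exact hl), mul_zero]
      exact zero_le
  · rw [Set.indicator_of_notMem (by exact ht)]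
    exact zero_le

/-- Averaging over rotations, `n` times the probability is the expected number of rotations that
code a forest. This is at most the expected absolute excess `E|S_n - n|`, hence at most the standard
deviation `s √n`. -/
theorem iidDegrees_forest_real_le {p : PMF ℕ} {s : ℝ} (h : IsCriticalWith p s) (n : ℕ) :
    (iidDegrees p n).real {x | List.ofFn x ∈ Set.range PlaneTree.forestDegrees} * n ≤ s * √n := by
  classical
  set μ := iidDegrees p n with hμ
  set Y : (Fin n → ℕ) → ℝ := fun x => ((∑ i, x i : ℕ) : ℝ) - n with hY
  have hsum : (∑ i : Fin n, fun x : Fin n → ℕ => (x i : ℝ)) = fun x => ((∑ i, x i : ℕ) : ℝ) := by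
    ext x; simp
  have hev : ∀ i : Fin n, MemLp (fun x : Fin n → ℕ => (x i : ℝ)) 2 μ := fun i =>
    h.memLp.comp_measurePreserving (measurePreserving_eval (fun _ : Fin n => p.toMeasure) i)
  have hS2 : MemLp (fun x : Fin n → ℕ => ((∑ i, x i : ℕ) : ℝ)) 2 μ := by
    rw [← hsum]
    exact memLp_finsetSum' _ fun i _ => hev i
  have hY2 : MemLp Y 2 μ := hS2.sub (memLp_const _)
  have hvar : Var[fun x : Fin n → ℕ => ((∑ i, x i : ℕ) : ℝ); μ] = n * s ^ 2 := by
    have := variance_sum_pi (μ := fun _ : Fin n => p.toMeasure) (X := fun _ (k : ℕ) => (k : ℝ))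
      fun _ => h.memLp
    rw [hsum, h.variance] at this
    rw [hμ, iidDegrees, this]
    simp
  have hmean : ∫ x, ((∑ i, x i : ℕ) : ℝ) ∂μ = n := by
    have h1 : ∀ i : Fin n, ∫ x : Fin n → ℕ, (x i : ℝ) ∂μ = 1 := fun i => by
      rw [← h.mean, ← (measurePreserving_eval (fun _ : Fin n => p.toMeasure) i).map_eq,
        integral_map (measurable_pi_apply i).aemeasurable (Measurable.of_discrete.aestronglyMeasurable)]
      rfl
    simp only [Nat.cast_sum]
    rw [integral_finsetSum _ fun i _ => (hev i).integrable (by norm_num)]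
    simp [h1]
  have hYsq : ∫ x, Y x ^ 2 ∂μ = n * s ^ 2 := by
    rw [← hvar, variance_eq_integral (Measurable.of_discrete.aemeasurable), hmean]
  have hYabs : ∫ x, |Y x| ∂μ ≤ s * √n := by
    -- Nonnegativity of this variance is `(E|Y|)² ≤ E Y²`.
    have h1 := variance_nonneg |Y| μ
    rw [variance_eq_sub hY2.abs] at h1
    have h2 : ∫ x, (|Y| ^ 2) x ∂μ = n * s ^ 2 := by
      rw [← hYsq]
      simp
    rw [h2] at h1
    refine abs_le_of_sq_le_sq' ?_ (by have := h.pos; positivity) |>.2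
    rw [mul_pow, Real.sq_sqrt (by positivity)]
    have h7 : ∫ x, |Y| x ∂μ = ∫ x, |Y x| ∂μ := rfl
    rw [h7] at h1
    linarith
  refine le_trans ?_ hYabs
  set F : Set (List ℕ) := Set.range PlaneTree.forestDegrees with hF
  have h3 : μ.real {x | List.ofFn x ∈ F} * n =
      ∫ x, ∑ k ∈ Finset.range n, {x | (List.ofFn x).rotate k ∈ F}.indicator (fun _ => (1 : ℝ)) x
        ∂μ := by
    rw [integral_finsetSum _ fun k _ => (integrable_const (1 : ℝ)).indicator
      MeasurableSet.of_discrete]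
    have h4 : ∀ k ∈ Finset.range n,
        ∫ x, {x | (List.ofFn x).rotate k ∈ F}.indicator (fun _ => (1 : ℝ)) x ∂μ =
          μ.real {x | List.ofFn x ∈ F} := fun k _ => by
      rw [integral_indicator_const _ MeasurableSet.of_discrete, measureReal_def, measureReal_def,
        hμ, iidDegrees_rotate]
      simp
    rw [Finset.sum_congr rfl h4]
    simp [mul_comm]
  rw [h3]
  refine integral_mono (integrable_finsetSum _ fun k _ => (integrable_const (1 : ℝ)).indicator
      MeasurableSet.of_discrete) ((hY2.integrable (by norm_num)).abs) fun x => ?_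
  have h5 := PlaneTree.card_forest_rotations_le (List.ofFn x)
    ((Finset.range n).filter fun k => (List.ofFn x).rotate k ∈ F) fun k hk => by
      rw [Finset.mem_filter] at hk
      exact ⟨by simpa using hk.1, hk.2⟩
  rw [excess_ofFn, Finset.card_filter] at h5
  have h6 : |Y x| = ((|((∑ i, x i : ℕ) : ℤ) - n| : ℤ) : ℝ) := by
    rw [hY]; push_cast; rfl
  rw [h6]
  refine le_trans (le_of_eq ?_) (Int.cast_le.2 h5)
  push_cast
  refine Finset.sum_congr rfl fun k _ => ?_
  rw [Set.indicator_apply]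
  rfl

end Masses

/-! ### Rotation at a good cut and the convolution bound. -/

section MainBound

open PlaneTree

/-- The triples formed by the degrees of a forest, a large tree, and a sequence that together make
up a rotation of the degree sequence of a tree of size `n`. -/
def cyclicTriples (n h : ℕ) : Set (List ℕ × PlaneTree × List ℕ) :=
  {z | z.1 ∈ Set.range forestDegrees ∧ (z.2.1.size ≤ n ∧ h ≤ z.2.1.hs) ∧
    z.1.length + z.2.1.size + z.2.2.length = n ∧ excess z.1 + excess z.2.2 = 0}

/-- The suffix forest splits as `us`, a large tree `v`, `ws`; the remainder is `ws` followed by the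
first `k` degrees. The total excess is `-1`, all of it used by `v`, so the other two parts cancel.
-/
theorem exists_cyclicTriple {n h k : ℕ} {t : PlaneTree} (ht : t.size = n) (hk : k < n)
    (hl : CodesLarge h (t.degrees.drop k)) :
    ∃ z ∈ cyclicTriples n h, z.1 ++ z.2.1.degrees ++ z.2.2 =
      t.degrees.drop k ++ t.degrees.take k := by
  obtain ⟨ts, hts, v, hv, hvh⟩ := hl
  obtain ⟨us, ws, rfl⟩ := List.append_of_mem hv
  have heq : forestDegrees us ++ v.degrees ++ (forestDegrees ws ++ t.degrees.take k) =
      t.degrees.drop k ++ t.degrees.take k := by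
    rw [← hts]
    simp
  have hlen := congrArg List.length heq
  have hex := congrArg excess heq
  simp only [List.length_append, List.length_take, List.length_drop, length_degrees] at hlen
  rw [excess_append (t.degrees.drop k), add_comm (excess (t.degrees.drop k)), ← excess_append,
    List.take_append_drop, excess_degrees, excess_append, excess_append, excess_degrees] at hex
  refine ⟨(forestDegrees us, v, forestDegrees ws ++ t.degrees.take k),
    ⟨⟨us, rfl⟩, ⟨?_, hvh⟩, ?_, ?_⟩, heq⟩
  · simp only
    omega
  · simp only [List.length_append, List.length_take, length_degrees]
    omega
  · simp only
    omega

theorem tsum_largeSuffixes_le (p : PMF ℕ) (n h : ℕ) :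
    ∑' t : PlaneTree, {t : PlaneTree | t.size = n}.indicator
        (fun t => t.weight p * largeSuffixes h t.degrees) t ≤
      ∑' z : List ℕ × PlaneTree × List ℕ, (cyclicTriples n h).indicator
        (fun z => listWeight p z.1 * (z.2.1.weight p * listWeight p z.2.2)) z := by
  classical
  set S : Set (PlaneTree × ℕ) :=
    {y | y.1.size = n ∧ y.2 < n ∧ CodesLarge h (y.1.degrees.drop y.2)} with hS
  have h1 : ∑' t : PlaneTree, {t : PlaneTree | t.size = n}.indicator
        (fun t => t.weight p * largeSuffixes h t.degrees) t =
      ∑' y : PlaneTree × ℕ, S.indicator (fun y => y.1.weight p) y := by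
    rw [ENNReal.tsum_prod']
    refine tsum_congr fun t => ?_
    by_cases ht : t.size = n
    · rw [Set.indicator_of_mem (by exact ht), largeSuffixes, length_degrees, ht,
        Finset.card_filter, tsum_eq_sum (s := Finset.range n)]
      · push_cast
        rw [Finset.mul_sum]
        refine Finset.sum_congr rfl fun k hk => ?_
        rw [Set.indicator_apply]
        have : (t, k) ∈ S ↔ CodesLarge h (t.degrees.drop k) := by
          simp only [hS, Set.mem_ofPred_eq]
          have := Finset.mem_range.1 hk
          tauto
        simp only [this]
        split_ifs <;> simp
      · intro k hk
        rw [Set.indicator_of_notMem]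
        rintro ⟨-, h2, -⟩
        exact hk (Finset.mem_range.2 h2)
    · rw [Set.indicator_of_notMem (by exact ht)]
      symm
      rw [ENNReal.tsum_eq_zero]
      intro k
      rw [Set.indicator_of_notMem]
      rintro ⟨h2, -⟩
      exact ht h2
  rw [h1, ← tsum_subtype, ← tsum_subtype]
  have hex : ∀ y : S, ∃ z ∈ cyclicTriples n h, z.1 ++ z.2.1.degrees ++ z.2.2 =
      y.1.1.degrees.drop y.1.2 ++ y.1.1.degrees.take y.1.2 := fun y =>
    exists_cyclicTriple y.2.1 y.2.2.1 y.2.2.2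
  choose f hf hfeq using hex
  -- The triple determines the rotated sequence, and `eq_of_rotation_eq` recovers from it the cut
  -- and the tree.
  have hinj : Function.Injective fun y : S => (⟨f y, hf y⟩ : cyclicTriples n h) := by
    rintro ⟨⟨t, k⟩, ht, hk, hy⟩ ⟨⟨t', k'⟩, ht', hk', hy'⟩ hyy
    have h2 := congrArg Subtype.val hyy
    simp only at h2
    have h3 := hfeq ⟨⟨t, k⟩, ht, hk, hy⟩
    have h4 := hfeq ⟨⟨t', k'⟩, ht', hk', hy'⟩
    rw [h2, h4] at h3
    simp only at h3 ht ht' hk hk'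
    have hne : ∀ (t : PlaneTree) (k : ℕ), t.size = n → k < n → t.degrees.drop k ≠ [] := by
      intro t k ht hk h0
      have := congrArg List.length h0
      rw [List.length_drop, length_degrees, ht, List.length_nil] at this
      omega
    obtain ⟨h5, h6⟩ := eq_of_rotation_eq (List.take_append_drop k t.degrees).symm
      (List.take_append_drop k' t'.degrees).symm (hne t k ht hk) (hne t' k' ht' hk') h3.symm
    have h7 : t = t' := degrees_injective (by
      rw [← List.take_append_drop k t.degrees, h5, h6, List.take_append_drop])
    have h8 := congrArg List.length h5
    rw [List.length_take, List.length_take, length_degrees, length_degrees] at h8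
    have h9 : k = k' := by omega
    subst h7 h9
    rfl
  refine le_trans (ENNReal.tsum_le_tsum fun y => ?_)
    (ENNReal.tsum_comp_le_tsum_of_injective hinj _)
  have h2 := congrArg (listWeight p) (hfeq y)
  simp only [listWeight_append] at h2
  rw [mul_comm (listWeight p (List.drop _ _)), ← listWeight_append p (List.take _ _),
    List.take_append_drop, ← weight_eq_listWeight, ← weight_eq_listWeight, mul_assoc] at h2
  exact h2.ge

/-- The convolution of the bounds for forests and for local probabilities is bounded. -/
theorem sum_inv_sqrt_mul_inv_sqrt_le (N : ℕ) :
    ∑ j ∈ Finset.range (N + 1), 1 / √((j : ℝ) + 1) * (1 / √(((N - j : ℕ) : ℝ) + 1)) ≤ 8 := by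
  have hsum : ∀ M : ℕ, ∑ j ∈ Finset.range M, 1 / √((j : ℝ) + 1) ≤ 2 * √M := by
    intro M
    induction M with
    | zero => simp
    | succ M ih =>
      rw [Finset.sum_range_succ]
      have h1 : 0 < √((M : ℝ) + 1) := by positivity
      have h2 : √((M : ℝ) + 1) ^ 2 = M + 1 := Real.sq_sqrt (by positivity)
      have h3 : √(M : ℝ) ^ 2 = M := Real.sq_sqrt (by positivity)
      have h4 : 1 / √((M : ℝ) + 1) ≤ 2 * √((M : ℝ) + 1) - 2 * √M := by
        rw [div_le_iff₀ h1]
        nlinarith [sq_nonneg (√((M : ℝ) + 1) - √M)]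
      push_cast
      linarith
  -- One of `j + 1` and `N - j + 1` is at least `(N + 2) / 2`, so one factor is at most `r`. The sum
  -- is then at most `4 r √(N + 1) ≤ 4 √2 ≤ 8`.
  set r : ℝ := √2 / √((N : ℝ) + 2) with hr
  have hterm : ∀ j ∈ Finset.range (N + 1),
      1 / √((j : ℝ) + 1) * (1 / √(((N - j : ℕ) : ℝ) + 1)) ≤
        r * (1 / √((j : ℝ) + 1)) + r * (1 / √(((N - j : ℕ) : ℝ) + 1)) := by
    intro j hj
    have hjN : j ≤ N := Nat.lt_succ_iff.1 (Finset.mem_range.1 hj)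
    have hkey : ∀ a : ℝ, 0 < a → ((N : ℝ) + 2) / 2 ≤ a → 1 / √a ≤ r := by
      intro a ha hNa
      rw [hr, div_le_div_iff₀ (by positivity) (by positivity), one_mul,
        ← Real.sqrt_mul (by norm_num)]
      apply Real.sqrt_le_sqrt
      linarith
    have hcast : ((N - j : ℕ) : ℝ) = N - j := Nat.cast_sub hjN
    have hr0 : 0 ≤ r := by positivity
    have ha : 0 ≤ 1 / √((j : ℝ) + 1) := by positivity
    have hb : 0 ≤ 1 / √(((N - j : ℕ) : ℝ) + 1) := by positivity
    rcases le_total (((N : ℝ) + 2) / 2) ((j : ℝ) + 1) with h1 | h1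
    · have := mul_le_mul_of_nonneg_right (hkey _ (by positivity) h1) hb
      have := mul_nonneg hr0 ha
      linarith
    · have := mul_le_mul_of_nonneg_left
        (hkey (((N - j : ℕ) : ℝ) + 1) (by positivity) (by rw [hcast]; linarith)) ha
      have := mul_nonneg hr0 hb
      linarith
  refine (Finset.sum_le_sum hterm).trans ?_
  rw [Finset.sum_add_distrib, ← Finset.mul_sum, ← Finset.mul_sum]
  have hrefl := Finset.sum_range_reflect (fun j : ℕ => 1 / √((j : ℝ) + 1)) (N + 1)
  have h1 : ∑ j ∈ Finset.range (N + 1), 1 / √(((N - j : ℕ) : ℝ) + 1) =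
      ∑ j ∈ Finset.range (N + 1), 1 / √((j : ℝ) + 1) := by
    rw [← hrefl]
    simp
  rw [h1]
  have h2 := hsum (N + 1)
  have hr0 : 0 ≤ r := by positivity
  have h3 : r * √((N + 1 : ℕ) : ℝ) ≤ √2 := by
    rw [hr, div_mul_eq_mul_div, div_le_iff₀ (by positivity)]
    gcongr
    push_cast
    linarith
  have h4 : √2 ≤ 2 := by
    rw [Real.sqrt_le_left (by norm_num)]
    norm_num
  have h5 := mul_le_mul_of_nonneg_left h2 hr0
  linarith

theorem exists_iidDegrees_forest_le {p : PMF ℕ} {s : ℝ} (h : IsCriticalWith p s) :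
    ∃ C : ℝ, 0 < C ∧ ∀ n : ℕ,
      (iidDegrees p n).real {x | List.ofFn x ∈ Set.range forestDegrees} ≤ C / √((n : ℝ) + 1) := by
  have hs := h.pos
  refine ⟨1 + s * √2, by positivity, fun n => ?_⟩
  rcases Nat.eq_zero_or_pos n with rfl | hn
  · refine measureReal_le_one.trans ?_
    simp
    positivity
  have hn' : (0 : ℝ) < n := by exact_mod_cast hn
  have h1 := iidDegrees_forest_real_le h n
  set R := (iidDegrees p n).real {x | List.ofFn x ∈ Set.range forestDegrees}
  rw [le_div_iff₀ (by positivity)]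
  have h2 : R * √n ≤ s := by
    have h3 : √(n : ℝ) * √n = n := Real.mul_self_sqrt hn'.le
    have h4 : 0 < √(n : ℝ) := Real.sqrt_pos.2 hn'
    exact le_of_mul_le_mul_right (by rwa [mul_assoc, h3]) h4
  have h5 : √((n : ℝ) + 1) ≤ √2 * √n := by
    rw [← Real.sqrt_mul (by norm_num)]
    apply Real.sqrt_le_sqrt
    have : (1 : ℝ) ≤ n := by exact_mod_cast hn
    linarith
  have h6 : 0 ≤ R := measureReal_nonneg
  calc R * √((n : ℝ) + 1) ≤ R * (√2 * √n) := by gcongr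
    _ = (R * √n) * √2 := by ring
    _ ≤ s * √2 := by gcongr
    _ ≤ 1 + s * √2 := by linarith

/-- For fixed `v` and forest code `l`, the length and the sum of the last part are prescribed, so
the local bound applies to it. Summing over `l` by length gives the bounded convolution, and the sum
over `v` is left. -/
theorem exists_tsum_cyclicTriples_le {p : PMF ℕ} {s : ℝ} (hp : IsCriticalWith p s) :
    ∃ K : ℝ, 0 < K ∧ ∀ n h : ℕ,
      ∑' z : List ℕ × PlaneTree × List ℕ, (cyclicTriples n h).indicator
        (fun z => listWeight p z.1 * (z.2.1.weight p * listWeight p z.2.2)) z ≤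
      ENNReal.ofReal K * galtonWatson p {t | t.size ≤ n ∧ h ≤ t.hs} := by
  classical
  obtain ⟨C, hC, hloc⟩ := hp.exists_iidDegrees_sum_le
  obtain ⟨D, hD, hfor⟩ := exists_iidDegrees_forest_le hp
  set F : Set (List ℕ) := Set.range forestDegrees with hF
  set G : ℕ → ℝ≥0∞ := fun m => ENNReal.ofReal (C / √((m : ℝ) + 1)) with hG
  have hlast : ∀ (m : ℕ) (e : ℤ),
      ∑' l, ({l : List ℕ | excess l = e} ∩ {l | l.length = m}).indicator (listWeight p) l ≤ G m := by
    intro m e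
    rw [← iidDegrees_apply, hG]
    simp only
    rw [ENNReal.le_ofReal_iff_toReal_le (measure_ne_top _ _) (by positivity)]
    -- If `m + e < 0` the event is empty, so the truncation is harmless.
    refine le_trans (measureReal_mono (fun x hx => ?_)) (hloc m (m + e).toNat)
    simp only [Set.mem_ofPred_eq, excess_ofFn] at hx ⊢
    omega
  have hconv : ∀ N : ℕ, ∑' l, (F ∩ {l | l.length ≤ N}).indicator
      (fun l => listWeight p l * G (N - l.length)) l ≤ ENNReal.ofReal (8 * (C * D)) := by
    intro N
    have h1 : ∀ l, (F ∩ {l | l.length ≤ N}).indicator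
        (fun l => listWeight p l * G (N - l.length)) l =
        ∑ j ∈ Finset.range (N + 1), (F ∩ {l | l.length = j}).indicator (listWeight p) l *
          G (N - j) := by
      intro l
      by_cases hl : l.length ≤ N
      · rw [Finset.sum_eq_single_of_mem l.length (by simpa using Nat.lt_succ_of_le hl)]
        · by_cases hlF : l ∈ F
          · rw [Set.indicator_of_mem (by exact ⟨hlF, hl⟩), Set.indicator_of_mem (by exact ⟨hlF, rfl⟩)]
          · rw [Set.indicator_of_notMem (fun h => hlF h.1),
              Set.indicator_of_notMem (fun h => hlF h.1), zero_mul]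
        · intro j _ hj
          rw [Set.indicator_of_notMem (fun h => hj h.2.symm), zero_mul]
      · rw [Set.indicator_of_notMem (fun h => hl h.2), Finset.sum_eq_zero]
        intro j hj
        rw [Set.indicator_of_notMem, zero_mul]
        rintro ⟨-, h2⟩
        have := Finset.mem_range.1 hj
        simp only [Set.mem_ofPred_eq] at h2
        omega
    simp_rw [h1]
    rw [Summable.tsum_finsetSum fun _ _ => ENNReal.summable]
    simp_rw [ENNReal.tsum_mul_right, ← iidDegrees_apply]
    calc ∑ j ∈ Finset.range (N + 1), iidDegrees p j {x | List.ofFn x ∈ F} * G (N - j)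
        ≤ ∑ j ∈ Finset.range (N + 1), ENNReal.ofReal ((C * D) *
            (1 / √((j : ℝ) + 1) * (1 / √(((N - j : ℕ) : ℝ) + 1)))) := by
          refine Finset.sum_le_sum fun j _ => ?_
          have h2 : iidDegrees p j {x | List.ofFn x ∈ F} ≤ ENNReal.ofReal (D / √((j : ℝ) + 1)) := by
            rw [ENNReal.le_ofReal_iff_toReal_le (measure_ne_top _ _) (by positivity)]
            exact hfor j
          refine (mul_le_mul_left h2 _).trans_eq ?_
          rw [hG]
          simp only
          rw [← ENNReal.ofReal_mul (by positivity)]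
          congr 1
          ring
      _ = ENNReal.ofReal (∑ j ∈ Finset.range (N + 1), (C * D) *
            (1 / √((j : ℝ) + 1) * (1 / √(((N - j : ℕ) : ℝ) + 1)))) := by
          rw [ENNReal.ofReal_sum_of_nonneg fun _ _ => by positivity]
      _ ≤ ENNReal.ofReal (8 * (C * D)) := by
          apply ENNReal.ofReal_le_ofReal
          rw [← Finset.mul_sum, mul_comm 8]
          gcongr
          exact sum_inv_sqrt_mul_inv_sqrt_le N
  refine ⟨8 * (C * D), by positivity, fun n h => ?_⟩
  rw [ENNReal.tsum_prod', galtonWatson_apply]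
  simp_rw [ENNReal.tsum_prod']
  rw [ENNReal.tsum_comm, ← ENNReal.tsum_mul_left]
  refine ENNReal.tsum_le_tsum fun v => ?_
  by_cases hv : v.size ≤ n ∧ h ≤ v.hs
  swap
  · rw [Set.indicator_of_notMem (by exact hv), mul_zero]
    refine le_of_eq ?_
    rw [ENNReal.tsum_eq_zero]
    intro l
    rw [ENNReal.tsum_eq_zero]
    intro m
    exact Set.indicator_of_notMem (fun hz => hv hz.2.1) _
  rw [Set.indicator_of_mem (by exact hv)]
  calc ∑' l, ∑' m, (cyclicTriples n h).indicator
        (fun z => listWeight p z.1 * (z.2.1.weight p * listWeight p z.2.2)) (l, v, m)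
      ≤ ∑' l, v.weight p * (F ∩ {l | l.length ≤ n - v.size}).indicator
          (fun l => listWeight p l * G (n - v.size - l.length)) l := by
        refine ENNReal.tsum_le_tsum fun l => ?_
        by_cases hl : l ∈ F ∧ l.length ≤ n - v.size
        · rw [Set.indicator_of_mem (by exact hl), ← mul_assoc]
          refine le_trans ?_ (mul_le_mul_right (hlast (n - v.size - l.length) (-excess l)) _)
          rw [← ENNReal.tsum_mul_left]
          refine ENNReal.tsum_le_tsum fun m => ?_
          by_cases hz : (l, v, m) ∈ cyclicTriples n h
          · rw [Set.indicator_of_mem hz, Set.indicator_of_mem]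
            · refine le_of_eq ?_
              ring
            · obtain ⟨-, -, h2, h3⟩ := hz
              simp only at h2 h3
              constructor <;> simp only [Set.mem_ofPred_eq] <;> omega
          · rw [Set.indicator_of_notMem hz]
            exact zero_le
        · refine le_trans (le_of_eq ?_) zero_le
          rw [ENNReal.tsum_eq_zero]
          intro m
          refine Set.indicator_of_notMem (fun hz => hl ⟨hz.1, ?_⟩) _
          obtain ⟨-, -, h2, -⟩ := hz
          simp only at h2
          omega
    _ ≤ ENNReal.ofReal (8 * (C * D)) * v.weight p := by
        rw [ENNReal.tsum_mul_left, mul_comm]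
        exact mul_le_mul_left (hconv _) _

theorem exists_mul_galtonWatson_le {p : PMF ℕ} {s : ℝ} (hp : IsCriticalWith p s) :
    ∃ K : ℝ, 0 < K ∧ ∀ n h : ℕ, n * galtonWatson p {t | t.size = n ∧ h < t.hs} ≤
      ENNReal.ofReal K * galtonWatson p {t | t.size ≤ n ∧ h ≤ t.hs} := by
  classical
  obtain ⟨K, hK, hle⟩ := exists_tsum_cyclicTriples_le hp
  refine ⟨2 * K, by positivity, fun n h => ?_⟩
  set f : PlaneTree → ℝ≥0∞ := {t : PlaneTree | t.size = n}.indicator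
    (fun t => t.weight p * largeSuffixes h t.degrees) with hf
  have hmir : Function.Injective mirror := fun s t hst => by
    rw [← mirror_mirror s, hst, mirror_mirror]
  -- Here `n` is the size of the tree, distributed by `size_le_largeSuffixes` over the good cuts in
  -- the two orientations.
  have h1 : n * galtonWatson p {t | t.size = n ∧ h < t.hs} ≤ ∑' t, (f t + f t.mirror) := by
    rw [galtonWatson_apply, ← ENNReal.tsum_mul_left]
    refine ENNReal.tsum_le_tsum fun t => ?_
    by_cases ht : t.size = n ∧ h < t.hs
    · rw [Set.indicator_of_mem (by exact ht), hf, Set.indicator_of_mem (by exact ht.1),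
        Set.indicator_of_mem (by simpa [size_mirror] using ht.1), weight_mirror, ← mul_add,
        mul_comm]
      gcongr
      have := size_le_largeSuffixes t ht.2
      rw [ht.1] at this
      exact_mod_cast this
    · rw [Set.indicator_of_notMem (by exact ht), mul_zero]
      exact zero_le
  refine h1.trans ?_
  rw [ENNReal.tsum_add]
  have h2 := (ENNReal.tsum_comp_le_tsum_of_injective hmir f)
  have h3 := (tsum_largeSuffixes_le p n h).trans (hle n h)
  calc ∑' t, f t + ∑' t : PlaneTree, f t.mirror ≤ ∑' t, f t + ∑' t, f t := by gcongr
    _ = 2 * ∑' t, f t := by rw [two_mul]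
    _ ≤ 2 * (ENNReal.ofReal K * galtonWatson p {t | t.size ≤ n ∧ h ≤ t.hs}) := by gcongr
    _ = _ := by
      rw [ENNReal.ofReal_mul (by norm_num), mul_assoc]
      simp

end MainBound

/-! ### Conclusion. -/

theorem theorem4 (p : PMF ℕ)
    (hmean : ∫ i : ℕ, (i : ℝ) ∂p.toMeasure = 1)
    (hvar_pos : 0 < evariance (fun i : ℕ => (i : ℝ)) p.toMeasure)
    (hvar_lt : evariance (fun i : ℕ => (i : ℝ)) p.toMeasure < ∞) :
    ∃ c : ℝ, ∀ n : ℕ, galtonWatson p {t | t.size = n} ≠ 0 → ∀ x : ℝ,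
      (cond (galtonWatson p) {t | t.size = n}).real {t | x ≤ (t.hs : ℝ)} ≤
        c * √(n : ℝ) * (iidDegrees p n).real {d | x - 2 ≤ (firstTreeHS d : ℝ)} := by
  obtain ⟨s, hp⟩ := exists_isCriticalWith hmean hvar_pos hvar_lt
  obtain ⟨K, hK, hmain⟩ := exists_mul_galtonWatson_le hp
  obtain ⟨c, hc, hlow⟩ := hp.exists_le_iidDegrees_sum
  refine ⟨max 1 (K / c), fun n hne x => ?_⟩
  have hn : 0 < n := by
    rcases Nat.eq_zero_or_pos n with rfl | hn
    · refine (hne ?_).elim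
      have : {t : PlaneTree | t.size = 0} = ∅ := by
        ext t
        have := t.size_pos
        simp
        omega
      rw [this, measure_empty]
    · exact hn
  have hn1 : (1 : ℝ) ≤ n := by exact_mod_cast hn
  have hsqrt : 1 ≤ √(n : ℝ) := Real.one_le_sqrt.2 hn1
  have htop : galtonWatson p {t | t.size = n} ≠ ∞ := by
    rw [galtonWatson_size_eq]
    exact measure_ne_top _ _
  have hprob := cond_isProbabilityMeasure_of_finite hne htop
  -- For `x ≤ 2` the event on the right is certain and `√n ≥ 1`, so the constant `1` in the maximum
  -- suffices.
  rcases le_or_gt x 2 with hx | hx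
  · have h1 : {d : Fin n → ℕ | x - 2 ≤ (firstTreeHS d : ℝ)} = Set.univ := by
      ext d
      have : (0 : ℝ) ≤ firstTreeHS d := Nat.cast_nonneg _
      simp only [Set.mem_ofPred_eq, Set.mem_univ, iff_true]
      linarith
    rw [h1, probReal_univ, mul_one]
    refine measureReal_le_one.trans ?_
    calc (1 : ℝ) = 1 * 1 := by norm_num
      _ ≤ max 1 (K / c) * √n := by gcongr; exact le_max_left _ _
  -- Since the number is an integer, `HS ≥ x` means `HS > h`. The main bound loses only one level,
  -- so `h ≥ x - 1`, which is more than needed.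
  · obtain ⟨h, hh⟩ : ∃ h : ℕ, ⌈x⌉₊ = h + 1 := ⟨⌈x⌉₊ - 1, by
      have : 0 < ⌈x⌉₊ := Nat.ceil_pos.2 (by linarith)
      omega⟩
    have hxh : x - 2 ≤ h := by
      have h1 := Nat.le_ceil x
      rw [hh] at h1
      push_cast at h1
      linarith
    set e := (iidDegrees p n).real {d | x - 2 ≤ (firstTreeHS d : ℝ)} with he
    have h1 : (galtonWatson p {t | t.size ≤ n ∧ h ≤ t.hs}).toReal ≤ e := by
      refine ENNReal.toReal_mono (measure_ne_top _ _)
        ((galtonWatson_le_firstTreeHS p n h).trans (measure_mono fun d hd => ?_))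
      have : (h : ℝ) ≤ firstTreeHS d := by exact_mod_cast hd
      simp only [Set.mem_ofPred_eq]
      linarith
    have hfin : galtonWatson p {t | t.size ≤ n ∧ h ≤ t.hs} ≠ ∞ :=
      ((galtonWatson_le_firstTreeHS p n h).trans_lt (measure_lt_top _ _)).ne
    have h2 := ENNReal.toReal_mono (ENNReal.mul_ne_top ENNReal.ofReal_ne_top hfin) (hmain n h)
    rw [ENNReal.toReal_mul, ENNReal.toReal_mul, ENNReal.toReal_ofReal hK.le,
      ENNReal.toReal_natCast] at h2
    have h3 := ENNReal.toReal_mono (ENNReal.mul_ne_top (ENNReal.natCast_ne_top n) htop)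
      (sum_le_galtonWatson_size p hn)
    rw [ENNReal.toReal_mul, ENNReal.toReal_natCast, ← measureReal_def] at h3
    have h4 := hlow n hn fun h0 => hne (le_antisymm ((galtonWatson_size_le_sum p).trans_eq
      ((measureReal_eq_zero_iff (measure_ne_top _ _)).1 h0)) zero_le)
    have hset : {t : PlaneTree | t.size = n} ∩ {t | x ≤ (t.hs : ℝ)} =
        {t | t.size = n ∧ h < t.hs} := by
      ext t
      simp only [Set.mem_inter_iff, Set.mem_ofPred_eq, ← Nat.ceil_le, hh, Nat.succ_le_iff]
    have hmeas : MeasurableSet {t : PlaneTree | t.size = n} := MeasurableSpace.measurableSet_top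
    rw [measureReal_def, cond_apply hmeas, hset, ENNReal.toReal_mul, ENNReal.toReal_inv]
    have ha : 0 < (galtonWatson p {t | t.size = n}).toReal := ENNReal.toReal_pos hne htop
    set a := (galtonWatson p {t | t.size = n}).toReal
    set b := (galtonWatson p {t | t.size = n ∧ h < t.hs}).toReal
    have he0 : 0 ≤ e := measureReal_nonneg
    have hn0 : (0 : ℝ) < n := by linarith
    rw [inv_mul_le_iff₀ ha]
    have h5 : c ≤ √n * (n * a) := h4.trans (by gcongr)
    have h6 : n * b ≤ K * e := h2.trans (by gcongr)
    have h7 : n * b ≤ n * (a * (K / c * √n * e)) := by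
      calc n * b ≤ K * e := h6
        _ = K / c * e * c := by field_simp
        _ ≤ K / c * e * (√n * (n * a)) := by gcongr
        _ = n * (a * (K / c * √n * e)) := by ring
    refine (le_of_mul_le_mul_left h7 hn0).trans ?_
    gcongr
    exact le_max_right _ _
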